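/- Let $G=\mathrm{GL}_n(q)$, $n\ge 2$, be the general linear group over a finite field $F_q$ of characteristic $p$, let $\ell\neq p$ be a prime, and let $R$ be a local principal ideal domain of characteristic $0$ with maximal ideal $\ell R$ that contains a primitive $p$-th root of unity. Put $K=R/\ell R$. Let $B$ be the subgroup of upper triangular matrices of $G$, view $S_n\subset G$ as the group of permutation matrices, and for $S\subseteq G$ write $\widehat S=\sum_{s\in S}s\in RG$. Let $$I=RG\cdot\sum_{\sigma\in S_n}\mathrm{sg}(\sigma)\,\sigma\widehat B$$ (the Steinberg lattice, a left ideal of $RG$), and let $f:I\times I\to R$ be the bilinear form obtained by restricting to $I$ the form on $RG$ given by $(g,h)\mapsto\delta_{g,h}$ for $g,h\in G$, and scaling it by $1/|B|$. For $c\ge 0$ let $I(c)=\{x\in I : f(x,I)\subseteq \ell^cR\}$, an $RG$-submodule of $I$. Let $L=I/\ell I$, a $KG$-module, and let $L(c)=(I(c)+\ell I)/\ell I$, a $KG$-submodule of $L$, so that $L=L(0)\supseteq L(1)\supseteq L(2)\supseteq\cdots$; put $M(c)=L(c)/L(c+1)$. Then the $KG$-module $M(0)=L(0)/L(1)=L/L(1)$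 is irreducible. Moreover, every proper $KG$-submodule of $L$ is contained in $L(1)$; that is, $L(1)$ is the unique maximal $KG$-submodule of $L$, and the intersection $\mathrm{rad}(L)$ of all maximal $KG$-submodules of $L$ is $L(1)$. -/

import Mathlib

open scoped MonoidAlgebra MatrixGroups

noncomputable section

namespace Steinberg

/-! ### The general linear group, its upper triangular subgroup, and permutation matrices -/

section Group

variable (n : ℕ) (F : Type*) [Field F]

/-- The subgroup `B` of upper triangular matrices of `GL_n(F)`. -/
def borel : Subgroup (GL (Fin n) F) where
  carrier := {g | ∀ i j : Fin n, j < i → (g : Matrix (Fin n) (Fin n) F) i j = 0}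
  one_mem' := fun i j hij => by simp [hij.ne']
  mul_mem' := by
    intro a b ha hb
    have h : Matrix.BlockTriangular
        ((a : Matrix (Fin n) (Fin n) F) * (b : Matrix (Fin n) (Fin n) F)) id :=
      Matrix.BlockTriangular.mul (fun i j hij => ha i j hij) (fun i j hij => hb i j hij)
    exact fun i j hij => h hij
  inv_mem' := by
    intro a ha
    have : Invertible (a : Matrix (Fin n) (Fin n) F) := a.invertible
    have h : Matrix.BlockTriangular (a : Matrix (Fin n) (Fin n) F)⁻¹ id :=
      Matrix.blockTriangular_inv_of_blockTriangular (fun i j hij => ha i j hij)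
    intro i j hij
    rw [Matrix.coe_units_inv]
    exact h hij

variable {n}

/-- The permutation matrix of `σ`, as an element of `GL_n(F)`: it sends the canonical basis vector
`e_i` to `e_{σ i}`. (Mathlib's `permMatrix` uses the inverse convention.) -/
def permGL (σ : Equiv.Perm (Fin n)) : GL (Fin n) F where
  val := (σ⁻¹).permMatrix F
  inv := σ.permMatrix F
  val_inv := by rw [← Matrix.permMatrix_mul]; simp
  inv_val := by rw [← Matrix.permMatrix_mul]; simp

theorem permGL_mulVec_single (σ : Equiv.Perm (Fin n)) (i : Fin n) :
    (permGL F σ : Matrix (Fin n) (Fin n) F).mulVec (Pi.single i 1) = Pi.single (σ i) 1 := by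
  ext j
  simp [permGL, PEquiv.toMatrix_apply, Pi.single_apply, Equiv.Perm.inv_def,
    Equiv.symm_apply_eq]

end Group

section Lattice

variable (n : ℕ) (F : Type*) [Field F] [Finite F] (R : Type*) [CommRing R]

/-- For a subset `S` of a finite group, the element `Ŝ = ∑_{s ∈ S} s` of the group algebra. -/
def hat {G : Type*} [Group G] [Finite G] (S : Set G) : R[G] :=
  ∑ s ∈ (Set.toFinite S).toFinset, MonoidAlgebra.of R G s

/-- The element `∑_{σ ∈ S_n} sg(σ) σ B̂` of the group algebra `RG`. -/
def steinbergElement : R[GL (Fin n) F] :=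
  ∑ σ : Equiv.Perm (Fin n), ((Equiv.Perm.sign σ : ℤ) : R) •
    (MonoidAlgebra.of R (GL (Fin n) F) (permGL F σ) *
      hat R (borel n F : Set (GL (Fin n) F)))

/-- The Steinberg lattice `I`: the left ideal of `RG` generated by `steinbergElement`. -/
def lattice : Ideal R[GL (Fin n) F] :=
  Ideal.span {steinbergElement n F R}

/-- The canonical symmetric bilinear form on `RG`, `(x, y) ↦ ∑_g x_g y_g`. -/
def canonicalForm (G : Type*) [Group G] : LinearMap.BilinForm R R[G] :=
  LinearMap.mk₂ R (fun x y => Finsupp.linearCombination R y.coeff x.coeff)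
    (fun x x' y => by simp)
    (fun r x y => by simp)
    (fun x y y' => by simp [Finsupp.linearCombination_apply, Finsupp.sum, mul_add,
      Finset.sum_add_distrib])
    (fun r x y => by simp [Finsupp.linearCombination_apply, Finsupp.sum, Finset.mul_sum,
      mul_left_comm])

theorem canonicalForm_of (G : Type*) [Group G] [DecidableEq G] (g h : G) :
    canonicalForm R G (MonoidAlgebra.of R G g) (MonoidAlgebra.of R G h) =
      if g = h then 1 else 0 := by
  simp [canonicalForm, Finsupp.single_apply, eq_comm]

theorem canonicalForm_eq_sum (G : Type*) [Group G] [Fintype G] (x y : R[G]) :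
    canonicalForm R G x y = ∑ g, x.coeff g * y.coeff g := by
  simp [canonicalForm, Finsupp.linearCombination_apply, Finsupp.sum_fintype]

theorem canonicalForm_of_mul (G : Type*) [Group G] [Finite G] (g : G) (x y : R[G]) :
    canonicalForm R G (MonoidAlgebra.of R G g * x) y =
      canonicalForm R G x (MonoidAlgebra.of R G g⁻¹ * y) := by
  have := Fintype.ofFinite G
  rw [canonicalForm_eq_sum, canonicalForm_eq_sum]
  refine Fintype.sum_equiv (Equiv.mulLeft g⁻¹) _ _ fun h => ?_
  simp [MonoidAlgebra.coeff_single_mul_apply]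

/-- Elements of `I` are fixed by right multiplication by `B`. -/
theorem coeff_mul_borel (x : R[GL (Fin n) F]) (hx : x ∈ lattice n F R) (g b : GL (Fin n) F)
    (hb : b ∈ borel n F) : x.coeff (g * b) = x.coeff g := by
  have h1 : hat R (borel n F : Set (GL (Fin n) F)) * MonoidAlgebra.of R _ b⁻¹ =
      hat R (borel n F : Set (GL (Fin n) F)) := by
    unfold hat
    rw [Finset.sum_mul]
    refine Finset.sum_bij' (fun s _ => s * b⁻¹) (fun s _ => s * b) ?_ ?_ ?_ ?_ ?_
    · intro a ha
      simp only [Set.Finite.mem_toFinset, SetLike.mem_coe] at ha ⊢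
      exact mul_mem ha (inv_mem hb)
    · intro a ha
      simp only [Set.Finite.mem_toFinset, SetLike.mem_coe] at ha ⊢
      exact mul_mem ha hb
    · simp
    · simp
    · intro a _
      rw [← map_mul]
  have h2 : x * MonoidAlgebra.of R _ b⁻¹ = x := by
    obtain ⟨a, rfl⟩ := Ideal.mem_span_singleton'.1 hx
    rw [mul_assoc]
    congr 1
    unfold steinbergElement
    rw [Finset.sum_mul]
    refine Finset.sum_congr rfl fun σ _ => ?_
    rw [smul_mul_assoc, mul_assoc, h1]
  conv_rhs => rw [← h2]
  simp [MonoidAlgebra.coeff_mul_single_apply]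

/-- The restriction of the canonical form to `I` can be scaled by `1/|B|` within `R`. -/
theorem exists_form : ∃ f : LinearMap.BilinForm R (lattice n F R),
    ∀ x y, (Nat.card (borel n F) : R) * f x y =
      canonicalForm R (GL (Fin n) F) (x : R[GL (Fin n) F]) (y : R[GL (Fin n) F]) := by
  classical
  have := Fintype.ofFinite (GL (Fin n) F)
  refine ⟨LinearMap.mk₂ R (fun x y => ∑ q : GL (Fin n) F ⧸ borel n F,
      (x : R[GL (Fin n) F]).coeff q.out * (y : R[GL (Fin n) F]).coeff q.out)
    (fun x x' y => by simp [add_mul, Finset.sum_add_distrib])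
    (fun r x y => by simp [Finset.mul_sum, mul_assoc])
    (fun x y y' => by simp [mul_add, Finset.sum_add_distrib])
    (fun r x y => by simp [Finset.mul_sum, mul_left_comm]), fun x y => ?_⟩
  rw [canonicalForm_eq_sum, LinearMap.mk₂_apply,
    ← Equiv.sum_comp (Subgroup.groupEquivQuotientProdSubgroup (s := borel n F)).symm,
    Fintype.sum_prod_type, Finset.mul_sum]
  refine Finset.sum_congr rfl fun q _ => ?_
  have key : ∀ b : borel n F, ∃ b' ∈ borel n F,
      (Subgroup.groupEquivQuotientProdSubgroup (s := borel n F)).symm (q, b) = q.out * b' := by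
    intro b
    set g := (Subgroup.groupEquivQuotientProdSubgroup (s := borel n F)).symm (q, b) with hg
    have hq : (QuotientGroup.mk g : GL (Fin n) F ⧸ borel n F) = q := by
      have : Subgroup.groupEquivQuotientProdSubgroup g = (q, b) := by rw [hg]; simp
      exact congrArg Prod.fst this
    refine ⟨q.out⁻¹ * g, QuotientGroup.eq.1 ?_, by simp⟩
    rw [hq]
    exact QuotientGroup.out_eq' q
  have key' : ∀ (b : borel n F) (z : lattice n F R), (z : R[GL (Fin n) F]).coeff
      ((Subgroup.groupEquivQuotientProdSubgroup (s := borel n F)).symm (q, b)) =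
      (z : R[GL (Fin n) F]).coeff q.out := by
    intro b z
    obtain ⟨b', hb', h⟩ := key b
    rw [h, coeff_mul_borel n F R _ z.2 _ _ hb']
  simp [key', Nat.card_eq_fintype_card]

/-- The bilinear form `f : I × I → R`: the restriction to `I` of the canonical form, scaled by
`1/|B|`. It is characterised by `form_spec`, as `|B|` is not a zero divisor in `R`. -/
def form : LinearMap.BilinForm R (lattice n F R) :=
  Classical.choose (exists_form n F R)

theorem form_spec (x y : lattice n F R) : (Nat.card (borel n F) : R) * form n F R x y =
    canonicalForm R (GL (Fin n) F) (x : R[GL (Fin n) F]) (y : R[GL (Fin n) F]) :=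
  Classical.choose_spec (exists_form n F R) x y

variable [IsDomain R] [CharZero R]

theorem form_of_smul (g : GL (Fin n) F) (x y : lattice n F R) :
    form n F R (MonoidAlgebra.of R _ g • x) y = form n F R x (MonoidAlgebra.of R _ g⁻¹ • y) := by
  have hB : (Nat.card (borel n F) : R) ≠ 0 := Nat.cast_ne_zero.2 Nat.card_pos.ne'
  apply mul_left_cancel₀ hB
  rw [form_spec, form_spec]
  exact canonicalForm_of_mul R _ g _ _

variable (ℓ : ℕ)

/-- The `RG`-submodule `I(c) = {x ∈ I | f(x, I) ⊆ ℓ^c R}` of `I`. -/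
def latticeFiltration (c : ℕ) : Submodule R[GL (Fin n) F] (lattice n F R) where
  carrier := {x | ∀ y, form n F R x y ∈ Ideal.span {(ℓ : R) ^ c}}
  zero_mem' := fun y => by simp
  add_mem' := fun {a b} ha hb y => by
    rw [map_add, LinearMap.add_apply]
    exact add_mem (ha y) (hb y)
  smul_mem' := by
    intro r x hx
    induction r using MonoidAlgebra.induction_linear with
    | zero => intro y; simp
    | add a b ha hb =>
      intro y
      rw [add_smul, map_add, LinearMap.add_apply]
      exact add_mem (ha y) (hb y)
    | single g a =>
      intro y
      have h : (MonoidAlgebra.single g a : R[GL (Fin n) F]) • x =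
          a • (MonoidAlgebra.of R _ g • x) := by
        rw [← smul_assoc]; simp
      rw [h, map_smul, LinearMap.smul_apply, form_of_smul]
      exact Submodule.smul_mem _ _ (hx _)

end Lattice

/-! ### The reduction of the Steinberg lattice modulo `ℓ` -/

section Reduction

variable (n : ℕ) (F : Type*) [Field F] [Finite F] (R : Type*) [CommRing R] (ℓ : ℕ)

/-- `K = R/ℓR`. -/
abbrev ResField : Type _ := R ⧸ Ideal.span {(ℓ : R)}

/-- The quotient `I/ℓI`, as a `K`-module. -/
abbrev LatticeMod : Type _ :=
  lattice n F R ⧸ (Ideal.span {(ℓ : R)} • ⊤ : Submodule R (lattice n F R))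

variable {R ℓ} in
/-- An endomorphism `φ` of an `R`-module `M` induces a `K`-linear endomorphism of `M/ℓM`. -/
def reduceEnd {M : Type*} [AddCommGroup M] [Module R M] (φ : M →ₗ[R] M) :
    (M ⧸ (Ideal.span {(ℓ : R)} • ⊤ : Submodule R M)) →ₗ[ResField R ℓ]
      (M ⧸ (Ideal.span {(ℓ : R)} • ⊤ : Submodule R M)) where
  toFun := Submodule.mapQ _ _ φ (Submodule.smul_top_le_comap_smul_top _ _)
  map_add' := map_add _
  map_smul' := fun k x => by
    obtain ⟨r, rfl⟩ := Ideal.Quotient.mk_surjective k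
    exact map_smul (Submodule.mapQ _ _ φ (Submodule.smul_top_le_comap_smul_top _ _)) r x

variable {R ℓ} in
theorem reduceEnd_mk {M : Type*} [AddCommGroup M] [Module R M] (φ : M →ₗ[R] M) (x : M) :
    reduceEnd (ℓ := ℓ) φ (Submodule.Quotient.mk x) = Submodule.Quotient.mk (φ x) := rfl

/-- The action of `G` on `I/ℓI` induced by its action on `I` by left multiplication. -/
def reductionRep : Representation (ResField R ℓ) (GL (Fin n) F) (LatticeMod n F R ℓ) where
  toFun g := reduceEnd
    (Algebra.lsmul R R (lattice n F R) (MonoidAlgebra.of R (GL (Fin n) F) g))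
  map_one' := by
    refine LinearMap.ext fun x => ?_
    obtain ⟨x, rfl⟩ := Submodule.Quotient.mk_surjective _ x
    rw [reduceEnd_mk, map_one, map_one]
    rfl
  map_mul' g h := by
    refine LinearMap.ext fun x => ?_
    obtain ⟨x, rfl⟩ := Submodule.Quotient.mk_surjective _ x
    rw [Module.End.mul_apply, reduceEnd_mk, reduceEnd_mk, reduceEnd_mk, map_mul, map_mul]
    rfl

theorem reductionRep_mk (g : GL (Fin n) F) (x : lattice n F R) :
    reductionRep n F R ℓ g (Submodule.Quotient.mk x) =
      Submodule.Quotient.mk (MonoidAlgebra.of R (GL (Fin n) F) g • x) := rfl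

/-- The `KG`-module `L = I/ℓI`. -/
abbrev Reduction : Type _ := (reductionRep n F R ℓ).asModule

/-- The canonical projection `I → L`. -/
def toReduction : lattice n F R →+ Reduction n F R ℓ :=
  (Submodule.mkQ (Ideal.span {(ℓ : R)} • ⊤ : Submodule R (lattice n F R))).toAddMonoidHom

theorem single_smul_toReduction (g : GL (Fin n) F) (r : R) (x : lattice n F R) :
    (MonoidAlgebra.single g (Ideal.Quotient.mk _ r) : (ResField R ℓ)[GL (Fin n) F]) •
        toReduction n F R ℓ x =
      toReduction n F R ℓ ((MonoidAlgebra.single g r : R[GL (Fin n) F]) • x) := by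
  have h : (MonoidAlgebra.single g r : R[GL (Fin n) F]) • x =
      r • (MonoidAlgebra.of R _ g • x) := by
    rw [← smul_assoc]; simp
  rw [h, Representation.single_smul]
  rfl

theorem ker_toReduction (x : lattice n F R) :
    toReduction n F R ℓ x = 0 ↔ ∃ y : lattice n F R, x = (ℓ : R) • y := by
  change Submodule.Quotient.mk x = (0 : LatticeMod n F R ℓ) ↔ _
  rw [Submodule.Quotient.mk_eq_zero, Submodule.ideal_span_singleton_smul,
    Submodule.mem_smul_pointwise_iff_exists]
  simp [eq_comm]

variable [IsDomain R] [CharZero R]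

/-- The `KG`-submodule `L(c) = (I(c) + ℓI)/ℓI` of `L`, i.e. the image of `I(c)` in `L`. -/
def filtration (c : ℕ) : Submodule (ResField R ℓ)[GL (Fin n) F] (Reduction n F R ℓ) where
  carrier := toReduction n F R ℓ '' (latticeFiltration n F R ℓ c : Set (lattice n F R))
  zero_mem' := ⟨0, zero_mem _, map_zero _⟩
  add_mem' := by
    rintro _ _ ⟨a, ha, rfl⟩ ⟨b, hb, rfl⟩
    exact ⟨a + b, add_mem ha hb, map_add _ _ _⟩
  smul_mem' := by
    rintro k _ ⟨x, hx, rfl⟩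
    induction k using MonoidAlgebra.induction_linear with
    | zero => exact ⟨0, zero_mem _, by simp⟩
    | add a b ha hb =>
      obtain ⟨u, hu, hu'⟩ := ha
      obtain ⟨v, hv, hv'⟩ := hb
      exact ⟨u + v, add_mem hu hv, by rw [map_add, hu', hv', add_smul]⟩
    | single g a =>
      obtain ⟨r, rfl⟩ := Ideal.Quotient.mk_surjective a
      exact ⟨(MonoidAlgebra.single g r : R[GL (Fin n) F]) • x, Submodule.smul_mem _ _ hx,
        (single_smul_toReduction n F R ℓ g r x).symm⟩

/-- The `KG`-module `M(c) = L(c)/L(c+1)`. -/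
abbrev Factor (c : ℕ) : Type _ :=
  filtration n F R ℓ c ⧸ (filtration n F R ℓ (c + 1)).submoduleOf (filtration n F R ℓ c)

end Reduction

end Steinberg

end

noncomputable section

namespace Steinberg

/-! ### Unitriangular matrices and their superdiagonal characters. -/

section Unitriangular

variable {n : ℕ} {F : Type*} [Field F]

/-! Let e be the generator of I and U the unitriangular group. U is a p-group, so |U| is a unit in
K. Fix a nontrivial additive character ψ of F with values in K. Each linear character u ↦ ψ(∑ ε_i
u_{i,i+1}) of U then has a projection, up to the factor |U|, given by `eigenSum`. The U-translates
of e span I (`lattice_le_span`), and the coefficient at the reversal permutation w₀ shows that the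
projection of e is not zero (`redCoeff_eigenSum_gen`). So every such character occurs in L with
multiplicity exactly one.

Two facts about the ε with entries in {0, 1} carry the proof. Every nonzero KG-module contains an
eigenvector for some such ε (`exists_isEigen`). A submodule of L that contains the regular
eigenvector, where all ε_i = 1, contains one for every such ε (`exists_isEigen_of_regular`). Hence a
regular eigenvector generates L (`eq_top_of_isEigen`): if it lay in a proper N, some character would
occur both in N and in L/N, against multiplicity one.

A proper N is therefore killed by the regular projection. By adjunction the orthogonal complement of
N contains a regular eigenvector for ψ⁻¹, so it is all of L, and N lies in L(1)
(`le_filtration_one`). Finally L(1) is proper because f(e, ue) = 1 for a suitable u in U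
(`form_gen_fullUnitri`). -/

theorem mul_apply_diag_of_upper {A B : Matrix (Fin n) (Fin n) F}
    (hA : ∀ i j, j < i → A i j = 0) (hB : ∀ i j, j < i → B i j = 0) (i : Fin n) :
    (A * B) i i = A i i * B i i := by
  rw [Matrix.mul_apply]
  refine Finset.sum_eq_single i (fun k _ hk => ?_) (by simp)
  rcases lt_or_gt_of_ne hk with h | h
  · rw [hA i k h, zero_mul]
  · rw [hB k i h, mul_zero]

/-- No index lies strictly between i and i + 1, so only two terms survive. This makes superdiagonal
entries additive on U. -/
theorem mul_apply_superdiag {A B : Matrix (Fin n) (Fin n) F}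
    (hA : ∀ i j, j < i → A i j = 0) (hB : ∀ i j, j < i → B i j = 0) {i j : Fin n}
    (hij : (j : ℕ) = i + 1) :
    (A * B) i j = A i i * B i j + A i j * B j j := by
  rw [Matrix.mul_apply]
  refine Finset.sum_eq_add i j (fun h => by rw [h] at hij; omega) (fun k _ hk => ?_)
    (by simp) (by simp)
  rcases lt_or_gt_of_ne hk.1 with h | h
  · rw [hA i k h, zero_mul]
  · rw [hB k j, mul_zero]
    have h1 := hk.2
    rw [Fin.lt_def] at h ⊢
    rw [ne_eq, Fin.ext_iff] at h1
    omega

variable (n F) in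
/-- The subgroup `U` of upper unitriangular matrices of `GL_n(F)`. -/
def unitri : Subgroup (GL (Fin n) F) where
  carrier := {g | g ∈ borel n F ∧ ∀ i, (g : Matrix (Fin n) (Fin n) F) i i = 1}
  one_mem' := ⟨one_mem _, fun i => by simp⟩
  mul_mem' := by
    rintro a b ⟨ha, ha'⟩ ⟨hb, hb'⟩
    refine ⟨mul_mem ha hb, fun i => ?_⟩
    rw [Units.val_mul, mul_apply_diag_of_upper ha hb, ha', hb', one_mul]
  inv_mem' := by
    rintro a ⟨ha, ha'⟩
    refine ⟨inv_mem ha, fun i => ?_⟩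
    have h := mul_apply_diag_of_upper ha ((borel n F).inv_mem ha) i
    rw [← Units.val_mul, mul_inv_cancel, ha', one_mul] at h
    simpa using h.symm

theorem unitri_le_borel : unitri n F ≤ borel n F := fun _ h => h.1

theorem unitri_apply_of_lt {u : GL (Fin n) F} (hu : u ∈ unitri n F) {i j : Fin n} (h : j < i) :
    (u : Matrix (Fin n) (Fin n) F) i j = 0 := hu.1 i j h

theorem unitri_apply_self {u : GL (Fin n) F} (hu : u ∈ unitri n F) (i : Fin n) :
    (u : Matrix (Fin n) (Fin n) F) i i = 1 := hu.2 i

theorem borel_apply_self_ne_zero {b : GL (Fin n) F} (hb : b ∈ borel n F) (i : Fin n) :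
    (b : Matrix (Fin n) (Fin n) F) i i ≠ 0 := by
  have h := mul_apply_diag_of_upper hb ((borel n F).inv_mem hb) i
  rw [← Units.val_mul, mul_inv_cancel] at h
  intro h0
  simp [h0] at h

/-- An upper unitriangular matrix, as an element of `GL_n(F)`. -/
def mkUnitri (A : Matrix (Fin n) (Fin n) F) (h : ∀ i j, j < i → A i j = 0) (h1 : ∀ i, A i i = 1) :
    GL (Fin n) F :=
  Matrix.GeneralLinearGroup.mkOfDetNeZero A <| by
    rw [Matrix.det_of_isUpperTriangular (fun i j hij => h i j hij)]
    simp [h1]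

theorem mkUnitri_mem (A : Matrix (Fin n) (Fin n) F) (h : ∀ i j, j < i → A i j = 0)
    (h1 : ∀ i, A i i = 1) : mkUnitri A h h1 ∈ unitri n F := ⟨h, h1⟩

theorem isPGroup_unitri (p : ℕ) [Fact p.Prime] [CharP F p] : IsPGroup p (unitri n F) := by
  rintro ⟨u, hu⟩
  refine ⟨n, ?_⟩
  rcases Nat.eq_zero_or_pos n with rfl | hn
  · ext i; exact i.elim0
  have : Nonempty (Fin n) := ⟨⟨0, hn⟩⟩
  -- Cayley–Hamilton makes u - 1 nilpotent; since n ≤ p ^ n, Frobenius gives u ^ (p ^ n) = 1.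
  have h1 : ((u : Matrix (Fin n) (Fin n) F) - 1) ^ n = 0 := by
    have h := Matrix.aeval_self_charpoly (u : Matrix (Fin n) (Fin n) F)
    rw [Matrix.charpoly_of_isUpperTriangular _ (fun i j hij => hu.1 i j hij)] at h
    simpa [unitri_apply_self hu] using h
  have h2 : ((u : Matrix (Fin n) (Fin n) F) - 1) ^ p ^ n = 0 :=
    pow_eq_zero_of_le (Nat.lt_pow_self (Fact.out : p.Prime).one_lt).le h1
  rw [sub_pow_char_pow_of_commute p n (Commute.one_right _), one_pow, sub_eq_zero] at h2
  ext1
  refine Units.ext ?_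
  simpa using h2

theorem card_unitri (p : ℕ) [Fact p.Prime] [CharP F p] [Finite F] :
    ∃ m, Nat.card (unitri n F) = p ^ m :=
  IsPGroup.iff_card.1 (isPGroup_unitri p)

/-- The linear form `∑ ε_i a_{i,i+1}` in the entries on the superdiagonal. -/
def superdiag (ε : Fin n → F) (A : Matrix (Fin n) (Fin n) F) : F :=
  ∑ i : Fin n, ∑ j : Fin n, if (j : ℕ) = i + 1 then ε i * A i j else 0

theorem superdiag_mul (ε : Fin n → F) {u v : GL (Fin n) F} (hu : u ∈ unitri n F)
    (hv : v ∈ unitri n F) :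
    superdiag ε (u * v : GL (Fin n) F) = superdiag ε u + superdiag ε v := by
  simp only [superdiag, ← Finset.sum_add_distrib]
  refine Finset.sum_congr rfl fun i _ => Finset.sum_congr rfl fun j _ => ?_
  split_ifs with h
  · rw [Units.val_mul, mul_apply_superdiag hu.1 hv.1 h, hu.2, hv.2]
    ring
  · simp

theorem superdiag_one (ε : Fin n → F) : superdiag ε (1 : GL (Fin n) F) = 0 := by
  have h := superdiag_mul ε (one_mem (unitri n F)) (one_mem _)
  rw [mul_one] at h
  simpa using h

theorem superdiag_inv (ε : Fin n → F) {u : GL (Fin n) F} (hu : u ∈ unitri n F) :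
    superdiag ε (u⁻¹ : GL (Fin n) F) = - superdiag ε u := by
  have h := superdiag_mul ε hu (inv_mem hu)
  rw [mul_inv_cancel, superdiag_one] at h
  exact (neg_eq_of_add_eq_zero_right h.symm).symm

end Unitriangular

/-! ### Permutation matrices and disjointness of Bruhat cells. -/

section Permutation

variable {n : ℕ} {F : Type*} [Field F]

theorem permGL_apply (σ : Equiv.Perm (Fin n)) (i j : Fin n) :
    (permGL F σ : Matrix (Fin n) (Fin n) F) i j = if i = σ j then 1 else 0 := by
  simp [permGL, PEquiv.toMatrix_apply, Equiv.Perm.inv_def, Equiv.symm_apply_eq]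

theorem permGL_mul_apply (σ : Equiv.Perm (Fin n)) (A : Matrix (Fin n) (Fin n) F) (i j : Fin n) :
    ((permGL F σ : Matrix (Fin n) (Fin n) F) * A) i j = A (σ⁻¹ i) j := by
  rw [Matrix.mul_apply, Finset.sum_eq_single (σ⁻¹ i)]
  · simp [permGL_apply]
  · intro k _ hk
    rw [permGL_apply, if_neg, zero_mul]
    rintro rfl
    simp at hk
  · simp

theorem mul_permGL_apply (σ : Equiv.Perm (Fin n)) (A : Matrix (Fin n) (Fin n) F) (i j : Fin n) :
    (A * (permGL F σ : Matrix (Fin n) (Fin n) F)) i j = A i (σ j) := by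
  rw [Matrix.mul_apply, Finset.sum_eq_single (σ j)]
  · simp [permGL_apply]
  · intro k _ hk
    rw [permGL_apply, if_neg hk, mul_zero]
  · simp

theorem permGL_mul (σ τ : Equiv.Perm (Fin n)) : permGL F (σ * τ) = permGL F σ * permGL F τ := by
  ext i j
  rw [Units.val_mul, permGL_mul_apply, permGL_apply, permGL_apply, Equiv.Perm.mul_apply]
  exact if_congr Equiv.Perm.inv_eq_iff_eq.symm rfl rfl

theorem permGL_one : permGL F (1 : Equiv.Perm (Fin n)) = 1 := by
  ext i j
  rw [permGL_apply, Units.val_one, Matrix.one_apply, Equiv.Perm.one_apply]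

theorem permGL_inv (σ : Equiv.Perm (Fin n)) : (permGL F σ)⁻¹ = permGL F σ⁻¹ := by
  rw [inv_eq_iff_mul_eq_one, ← permGL_mul, mul_inv_cancel, permGL_one]

/-- Entries of `σ⁻¹ g τ`. -/
theorem permGL_inv_mul_mul_apply (σ τ : Equiv.Perm (Fin n)) (g : GL (Fin n) F) (i j : Fin n) :
    (((permGL F σ)⁻¹ * g * permGL F τ : GL (Fin n) F) : Matrix (Fin n) (Fin n) F) i j =
      (g : Matrix (Fin n) (Fin n) F) (σ i) (τ j) := by
  rw [Units.val_mul, mul_permGL_apply, Units.val_mul, permGL_inv, permGL_mul_apply, inv_inv]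

/-- Two permutations that are comparable pointwise are equal. -/
theorem perm_eq_of_le {σ τ : Equiv.Perm (Fin n)} (h : ∀ i, σ i ≤ τ i) : σ = τ := by
  have hs : ∑ i, ((σ i : Fin n) : ℕ) = ∑ i, ((τ i : Fin n) : ℕ) := by
    rw [Equiv.sum_comp σ (fun i : Fin n => (i : ℕ)), Equiv.sum_comp τ (fun i : Fin n => (i : ℕ))]
  have h2 := (Finset.sum_eq_sum_iff_of_le (fun i _ => Fin.le_def.1 (h i))).1 hs
  ext i
  exact h2 i (Finset.mem_univ i)

/-- If `u ∈ U` and `u σ ∈ τ B` then `σ = τ`. -/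
theorem eq_of_mem_borel {u : GL (Fin n) F} (hu : u ∈ unitri n F) {σ τ : Equiv.Perm (Fin n)}
    (h : (permGL F τ)⁻¹ * u * permGL F σ ∈ borel n F) : τ = σ := by
  refine perm_eq_of_le fun i => ?_
  by_contra hlt
  -- The diagonal entry of τ⁻¹uσ at i is the entry of u at (τ i, σ i), which can be nonzero only if
  -- τ i ≤ σ i.
  refine borel_apply_self_ne_zero h i ?_
  rw [permGL_inv_mul_mul_apply]
  exact unitri_apply_of_lt hu (not_le.1 hlt)

end Permutation

/-! ### Coefficients of the Steinberg element. -/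

section Element

variable {n : ℕ} {F : Type*} [Field F] [Finite F] {R : Type*} [CommRing R]

theorem coeff_hat {G : Type*} [Group G] [Finite G] (S : Set G) [DecidablePred (· ∈ S)] (g : G) :
    (hat R S).coeff g = if g ∈ S then 1 else 0 := by
  classical
  simp [hat, Finsupp.single_apply]

theorem hat_borel_mul {b : GL (Fin n) F} (hb : b ∈ borel n F) :
    MonoidAlgebra.of R _ b * hat R (borel n F : Set (GL (Fin n) F)) =
      hat R (borel n F : Set (GL (Fin n) F)) := by
  classical
  ext g
  rw [MonoidAlgebra.of_apply, MonoidAlgebra.coeff_single_mul_apply, coeff_hat, coeff_hat, one_mul]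
  refine if_congr ?_ rfl rfl
  exact Subgroup.mul_mem_cancel_left _ (inv_mem hb)

variable (R) in
/-- The element `g B̂` of the group algebra. -/
def cosetSum (g : GL (Fin n) F) : R[GL (Fin n) F] :=
  MonoidAlgebra.of R _ g * hat R (borel n F : Set (GL (Fin n) F))

theorem of_mul_cosetSum (g h : GL (Fin n) F) :
    MonoidAlgebra.of R _ g * cosetSum R h = cosetSum R (g * h) := by
  rw [cosetSum, cosetSum, map_mul, mul_assoc]

theorem cosetSum_eq {g h : GL (Fin n) F} (hgh : g⁻¹ * h ∈ borel n F) :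
    cosetSum R g = cosetSum R h := by
  have : h = g * (g⁻¹ * h) := by group
  rw [this, cosetSum, cosetSum, map_mul, mul_assoc, hat_borel_mul hgh]

theorem coeff_cosetSum [DecidablePred (· ∈ borel n F)] (g h : GL (Fin n) F) :
    (cosetSum R g).coeff h = if g⁻¹ * h ∈ borel n F then 1 else 0 := by
  rw [cosetSum, MonoidAlgebra.of_apply, MonoidAlgebra.coeff_single_mul_apply, coeff_hat, one_mul]
  rfl

theorem steinbergElement_eq : steinbergElement n F R =
    ∑ σ : Equiv.Perm (Fin n), ((Equiv.Perm.sign σ : ℤ) : R) • cosetSum R (permGL F σ) := rfl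

/-- By `eq_of_mem_borel`, uσ can lie in τB only for τ = σ, so a single summand contributes. -/
theorem coeff_steinbergElement [DecidablePred (· ∈ borel n F)] {u : GL (Fin n) F}
    (hu : u ∈ unitri n F) (σ : Equiv.Perm (Fin n)) :
    (steinbergElement n F R).coeff (u * permGL F σ) =
      if (permGL F σ)⁻¹ * u * permGL F σ ∈ borel n F then ((Equiv.Perm.sign σ : ℤ) : R) else 0 := by
  simp only [steinbergElement_eq, MonoidAlgebra.coeff_sum, MonoidAlgebra.coeff_smul,
    Finsupp.coe_finsetSum, Finset.sum_apply, Finsupp.smul_apply, coeff_cosetSum]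
  rw [Finset.sum_eq_single σ]
  · simp [mul_assoc]
  · intro τ _ hτ
    rw [if_neg, smul_zero]
    intro h
    rw [← mul_assoc] at h
    exact hτ (eq_of_mem_borel hu h)
  · simp

variable (n F R) in
/-- The generator of the Steinberg lattice, as an element of it. -/
def gen : lattice n F R := ⟨steinbergElement n F R, Ideal.mem_span_singleton_self _⟩

end Element

/-! ### The rank-one straightening relation. -/

section Straightening

variable {n : ℕ} {F : Type*} [Field F]

/-- The transvection `1 + c E_{ij}`, as an element of `GL_n(F)`. -/
def transGL {i j : Fin n} (h : i ≠ j) (c : F) : GL (Fin n) F where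
  val := Matrix.transvection i j c
  inv := Matrix.transvection i j (-c)
  val_inv := by rw [Matrix.transvection_mul_transvection_same _ _ h]; simp
  inv_val := by rw [Matrix.transvection_mul_transvection_same _ _ h]; simp

theorem transGL_apply {i j : Fin n} (h : i ≠ j) (c : F) (a b : Fin n) :
    (transGL h c : Matrix (Fin n) (Fin n) F) a b =
      (if a = b then 1 else 0) + if i = a ∧ j = b then c else 0 := by
  simp [transGL, Matrix.transvection, Matrix.one_apply, Matrix.single_apply]

theorem transGL_inv {i j : Fin n} (h : i ≠ j) (c : F) : (transGL h c)⁻¹ = transGL h (-c) :=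
  Units.ext rfl

theorem transGL_zero {i j : Fin n} (h : i ≠ j) : transGL h (0 : F) = 1 :=
  Units.ext (Matrix.transvection_zero i j)

theorem transGL_mem_unitri {i j : Fin n} (h : i < j) (c : F) : transGL h.ne c ∈ unitri n F := by
  constructor
  · intro a b hab
    rw [transGL_apply, if_neg hab.ne', if_neg, add_zero]
    rintro ⟨rfl, rfl⟩
    exact lt_asymm h hab
  · intro a
    rw [transGL_apply, if_pos rfl, if_neg, add_zero]
    rintro ⟨rfl, rfl⟩
    exact lt_irrefl _ h

theorem permGL_conj_transGL {i j : Fin n} (h : i ≠ j) (c : F) (σ : Equiv.Perm (Fin n)) :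
    (permGL F σ)⁻¹ * transGL h c * permGL F σ =
      transGL (σ⁻¹.injective.ne h) c := by
  ext a b
  rw [permGL_inv_mul_mul_apply, transGL_apply, transGL_apply]
  simp [Equiv.symm_apply_eq]

/-- A conjugate of a matrix with a single off-diagonal entry is upper triangular if that entry is
moved above the diagonal. -/
theorem conj_mem_borel {h : GL (Fin n) F} {i j : Fin n}
    (hh : ∀ a b, a ≠ b → ¬ (a = i ∧ b = j) → (h : Matrix (Fin n) (Fin n) F) a b = 0)
    {σ : Equiv.Perm (Fin n)} (hσ : σ⁻¹ i < σ⁻¹ j) :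
    (permGL F σ)⁻¹ * h * permGL F σ ∈ borel n F := by
  intro a b hab
  rw [permGL_inv_mul_mul_apply]
  refine hh _ _ (σ.injective.ne hab.ne') ?_
  rintro ⟨rfl, rfl⟩
  simp only [Equiv.Perm.inv_def, Equiv.symm_apply_apply] at hσ
  exact lt_asymm hab hσ

/-- This is the Bruhat identity of GL₂: on the coordinates i, j the product has rows (a, 1) and (0,
-a⁻¹), and elsewhere it is the identity. -/
theorem swap_transGL_eq_zero {i j : Fin n} (hij : i ≠ j) {a : F} (ha : a ≠ 0) (k l : Fin n)
    (hkl : k ≠ l) (hkl' : ¬ (k = i ∧ l = j)) :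
    ((permGL F (Equiv.swap i j) * transGL hij (-a⁻¹) * permGL F (Equiv.swap i j) *
      transGL hij a * permGL F (Equiv.swap i j) : GL (Fin n) F) :
        Matrix (Fin n) (Fin n) F) k l = 0 := by
  have h1 : permGL F (Equiv.swap i j) * transGL hij (-a⁻¹) * permGL F (Equiv.swap i j) =
      transGL hij.symm (-a⁻¹) := by
    have h := permGL_conj_transGL hij (-a⁻¹) (Equiv.swap i j)
    rw [permGL_inv, Equiv.swap_inv] at h
    rw [h]
    congr 1 <;> simp
  rw [h1, Units.val_mul, mul_permGL_apply, Units.val_mul]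
  change (Matrix.transvection j i (-a⁻¹) * Matrix.transvection i j a) k _ = 0
  simp only [Matrix.transvection, add_mul, mul_add, one_mul, mul_one,
    Matrix.single_mul_single_same, Matrix.add_apply, Matrix.one_apply, Matrix.single_apply,
    neg_mul, inv_mul_cancel₀ ha]
  by_cases hki : k = i
  · subst hki
    have hlj : l ≠ j := fun h => hkl' ⟨rfl, h⟩
    rw [Equiv.swap_apply_of_ne_of_ne hkl.symm hlj]
    simp [hkl, hij.symm, hlj.symm]
  · by_cases hkj : k = j
    · subst hkj
      by_cases hli : l = i
      · subst hli
        simp [hij]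
      · rw [Equiv.swap_apply_of_ne_of_ne hli hkl.symm]
        simp [hkl, Ne.symm hli, hij]
    · have : Equiv.swap i j l ≠ k := by
        rw [ne_eq, Equiv.swap_apply_eq_iff, Equiv.swap_apply_of_ne_of_ne hki hkj]
        exact hkl.symm
      simp [this.symm, Ne.symm hki, Ne.symm hkj]

variable [Finite F] {R : Type*} [CommRing R]

theorem permGL_mul_steinbergElement (s : Equiv.Perm (Fin n)) :
    MonoidAlgebra.of R _ (permGL F s) * steinbergElement n F R =
      ((Equiv.Perm.sign s : ℤ) : R) • steinbergElement n F R := by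
  rw [steinbergElement_eq, Finset.mul_sum, Finset.smul_sum]
  refine Fintype.sum_equiv (Equiv.mulLeft s) _ _ fun σ => ?_
  rw [mul_smul_comm, of_mul_cosetSum, ← permGL_mul, smul_smul, Equiv.coe_mulLeft,
    Equiv.Perm.sign_mul, Units.val_mul, Int.cast_mul, ← mul_assoc, ← Int.cast_mul, ← Units.val_mul,
    Int.units_mul_self]
  simp

theorem diagonal_mul_steinbergElement {t : GL (Fin n) F}
    (ht : ∀ a b, a ≠ b → (t : Matrix (Fin n) (Fin n) F) a b = 0) :
    MonoidAlgebra.of R _ t * steinbergElement n F R = steinbergElement n F R := by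
  rw [steinbergElement_eq, Finset.mul_sum]
  refine Finset.sum_congr rfl fun σ _ => ?_
  rw [mul_smul_comm, of_mul_cosetSum]
  congr 1
  symm
  refine cosetSum_eq fun a b hab => ?_
  rw [← mul_assoc, permGL_inv_mul_mul_apply]
  exact ht _ _ (σ.injective.ne hab.ne')

/-- The defect `T σ` of the relation on the coset σB is the same for σ and sσ, while the sign
changes, so the alternating sum of the defects vanishes. -/
theorem swap_mul_transGL_mul_steinbergElement {i j : Fin n} (hne : i ≠ j)
    {a : F} (ha : a ≠ 0) :
    MonoidAlgebra.of R _ (permGL F (Equiv.swap i j) * transGL hne a) * steinbergElement n F R =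
      MonoidAlgebra.of R _ (transGL hne a⁻¹) * steinbergElement n F R -
        steinbergElement n F R := by
  set s := Equiv.swap i j with hs
  have hx : ∀ (c : F) (σ : Equiv.Perm (Fin n)), σ⁻¹ i < σ⁻¹ j →
      cosetSum R (transGL hne c * permGL F σ) = cosetSum R (permGL F σ) := by
    intro c σ hσ
    symm
    refine cosetSum_eq ?_
    rw [← mul_assoc]
    refine conj_mem_borel (i := i) (j := j) (fun k l hkl hkl' => ?_) hσ
    rw [transGL_apply, if_neg hkl, if_neg, add_zero]
    rintro ⟨rfl, rfl⟩
    exact hkl' ⟨rfl, rfl⟩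
  set T : Equiv.Perm (Fin n) → R[GL (Fin n) F] := fun σ =>
    cosetSum R (permGL F s * transGL hne a * permGL F σ) -
      cosetSum R (transGL hne a⁻¹ * permGL F σ) + cosetSum R (permGL F σ) with hT
  -- One of σ and sσ satisfies this inequality, and then the transvections at (i, j) fix its coset.
  -- For such σ both `T σ` and `T (s * σ)` equal the coset sum of sσ, the second by the GL₂
  -- identity.
  have h1 : ∀ σ : Equiv.Perm (Fin n), σ⁻¹ i < σ⁻¹ j → T σ = cosetSum R (permGL F (s * σ)) := by
    intro σ hσ
    simp only [hT]
    rw [hx _ _ hσ, sub_add_cancel, mul_assoc, ← of_mul_cosetSum, hx _ _ hσ, of_mul_cosetSum,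
      permGL_mul]
  have h2 : ∀ σ : Equiv.Perm (Fin n), σ⁻¹ i < σ⁻¹ j →
      T (s * σ) = cosetSum R (permGL F (s * σ)) := by
    intro σ hσ
    simp only [hT]
    rw [add_eq_right, sub_eq_zero]
    symm
    refine cosetSum_eq ?_
    have h := conj_mem_borel (swap_transGL_eq_zero hne ha) hσ
    rw [← hs] at h
    convert h using 1
    rw [permGL_mul, mul_inv_rev, mul_inv_rev, transGL_inv, permGL_inv s]
    simp only [hs, Equiv.swap_inv]
    group
  have h3 : ∀ σ : Equiv.Perm (Fin n), T σ = T (s * σ) := by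
    intro σ
    rcases lt_or_gt_of_ne (σ⁻¹.injective.ne hne) with h | h
    · rw [h1 σ h, h2 σ h]
    · have h' : (s * σ)⁻¹ i < (s * σ)⁻¹ j := by
        rw [mul_inv_rev, hs, Equiv.swap_inv]
        simpa using h
      have e1 := h1 _ h'
      have e2 := h2 _ h'
      rw [← mul_assoc, hs, Equiv.swap_mul_self, one_mul] at e1 e2
      exact e2.trans e1.symm
  have h4 : ∑ σ, ((Equiv.Perm.sign σ : ℤ) : R) • T σ = 0 := by
    refine Finset.sum_involution (fun σ _ => s * σ) ?_ ?_ (by simp) ?_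
    · intro σ _
      rw [← h3 σ, ← add_smul, Equiv.Perm.sign_mul, hs, Equiv.Perm.sign_swap hne]
      simp
    · intro σ _ _ h
      rw [mul_eq_right, hs, Equiv.swap_eq_one_iff] at h
      exact hne h
    · intro σ _
      rw [← mul_assoc, hs, Equiv.swap_mul_self, one_mul]
  rw [← sub_eq_zero, ← h4, sub_sub_eq_add_sub, add_sub_right_comm, steinbergElement_eq,
    Finset.mul_sum, Finset.mul_sum, ← Finset.sum_sub_distrib, ← Finset.sum_add_distrib]
  refine Finset.sum_congr rfl fun σ _ => ?_
  rw [hT, mul_smul_comm, mul_smul_comm, of_mul_cosetSum, of_mul_cosetSum, smul_add, smul_sub]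

end Straightening

/-! ### The lattice is spanned by the U-translates of its generator. -/

section Spanning

variable {n : ℕ} {F : Type*} [Field F]

theorem borel_conj_mem_unitri {t u : GL (Fin n) F} (ht : t ∈ borel n F) (hu : u ∈ unitri n F) :
    t * u * t⁻¹ ∈ unitri n F := by
  refine ⟨mul_mem (mul_mem ht hu.1) (inv_mem ht), fun i => ?_⟩
  rw [Units.val_mul, mul_apply_diag_of_upper (mul_mem ht hu.1) ((borel n F).inv_mem ht),
    Units.val_mul, mul_apply_diag_of_upper ht hu.1, hu.2, mul_one,
    ← mul_apply_diag_of_upper ht ((borel n F).inv_mem ht), ← Units.val_mul, mul_inv_cancel]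
  simp

/-- An adjacent transposition reverses the order of the pair (i, i + 1) only, so the entry there is
the only obstruction. -/
theorem swap_conj_mem_unitri {i j : Fin n} (hij : (j : ℕ) = i + 1) {u : GL (Fin n) F}
    (hu : u ∈ unitri n F) (h0 : (u : Matrix (Fin n) (Fin n) F) i j = 0) :
    (permGL F (Equiv.swap i j))⁻¹ * u * permGL F (Equiv.swap i j) ∈ unitri n F := by
  refine ⟨fun a b hab => ?_, fun a => ?_⟩
  · rw [permGL_inv_mul_mul_apply]
    by_cases h : Equiv.swap i j a = i ∧ Equiv.swap i j b = j
    · rw [h.1, h.2, h0]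
    · apply unitri_apply_of_lt hu
      rw [Equiv.swap_apply_def, Equiv.swap_apply_def] at h ⊢
      simp only [Fin.lt_def] at hab ⊢
      simp only [Fin.ext_iff] at h ⊢
      split_ifs at h ⊢ <;> simp_all <;> omega
  · rw [permGL_inv_mul_mul_apply, hu.2]

variable [Finite F] {R : Type*} [CommRing R]

variable (n F R) in
/-- The `R`-span of the `U`-translates of the generator of the Steinberg lattice. -/
def unitriSpan : Submodule R R[GL (Fin n) F] :=
  Submodule.span R (Set.range fun u : unitri n F =>
    MonoidAlgebra.of R _ (u : GL (Fin n) F) * steinbergElement n F R)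

theorem mul_mem_unitriSpan {u : GL (Fin n) F} (hu : u ∈ unitri n F) :
    MonoidAlgebra.of R _ u * steinbergElement n F R ∈ unitriSpan n F R :=
  Submodule.subset_span ⟨⟨u, hu⟩, rfl⟩

theorem steinbergElement_mem_unitriSpan : steinbergElement n F R ∈ unitriSpan n F R := by
  have h := mul_mem_unitriSpan (R := R) (one_mem (unitri n F))
  rwa [map_one, one_mul] at h

variable (n F R) in
/-- The elements of `G` that stabilize `unitriSpan`. -/
def unitriSpanStabilizer : Submonoid (GL (Fin n) F) where
  carrier := {g | ∀ x ∈ unitriSpan n F R, MonoidAlgebra.of R _ g * x ∈ unitriSpan n F R}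
  one_mem' := fun x hx => by rwa [map_one, one_mul]
  mul_mem' := fun {a b} ha hb x hx => by
    rw [map_mul, mul_assoc]
    exact ha _ (hb _ hx)

theorem mem_unitriSpanStabilizer {g : GL (Fin n) F}
    (h : ∀ u ∈ unitri n F, MonoidAlgebra.of R _ (g * u) * steinbergElement n F R ∈
      unitriSpan n F R) : g ∈ unitriSpanStabilizer n F R := by
  intro x hx
  induction hx using Submodule.span_induction with
  | mem x hx =>
    obtain ⟨u, rfl⟩ := hx
    rw [← mul_assoc, ← map_mul]
    exact h u u.2
  | zero => simp
  | add x y _ _ hx hy => rw [mul_add]; exact add_mem hx hy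
  | smul a x _ hx => rw [mul_smul_comm]; exact Submodule.smul_mem _ _ hx

theorem unitri_mem_stabilizer {g : GL (Fin n) F} (hg : g ∈ unitri n F) :
    g ∈ unitriSpanStabilizer n F R :=
  mem_unitriSpanStabilizer fun _ hu => mul_mem_unitriSpan (mul_mem hg hu)

theorem diagonal_mem_stabilizer {t : GL (Fin n) F}
    (ht : ∀ a b, a ≠ b → (t : Matrix (Fin n) (Fin n) F) a b = 0) :
    t ∈ unitriSpanStabilizer n F R := by
  refine mem_unitriSpanStabilizer fun u hu => ?_
  have h : t * u = t * u * t⁻¹ * t := by group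
  rw [h, map_mul, mul_assoc, diagonal_mul_steinbergElement ht]
  exact mul_mem_unitriSpan (borel_conj_mem_unitri (fun i j hij => ht i j hij.ne') hu)

theorem swap_mem_stabilizer {i j : Fin n} (hij : (j : ℕ) = i + 1) :
    permGL F (Equiv.swap i j) ∈ unitriSpanStabilizer n F R := by
  refine mem_unitriSpanStabilizer fun u hu => ?_
  have hlt : i < j := by rw [Fin.lt_def]; omega
  set s := permGL F (Equiv.swap i j) with hs
  set a := (u : Matrix (Fin n) (Fin n) F) i j with ha
  have hss : s⁻¹ = s := by rw [hs, permGL_inv, Equiv.swap_inv]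
  -- Split the entry a off u: what remains is conjugated into U by s, and the factor s · (1 + a
  -- E_{ij}) is left to the straightening relation.
  have hu' : u * transGL hlt.ne (-a) ∈ unitri n F := mul_mem hu (transGL_mem_unitri hlt _)
  have h0 : ((u * transGL hlt.ne (-a) : GL (Fin n) F) : Matrix (Fin n) (Fin n) F) i j = 0 := by
    rw [Units.val_mul, mul_apply_superdiag hu.1 (transGL_mem_unitri hlt _).1 hij, hu.2,
      (transGL_mem_unitri hlt _).2, transGL_apply, ← ha]
    simp [hlt.ne]
  have hv := swap_conj_mem_unitri hij hu' h0
  have h : s * u = s⁻¹ * (u * transGL hlt.ne (-a)) * s * (s * transGL hlt.ne a) := by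
    have hss' : s * s = 1 := by nth_rw 1 [← hss]; exact inv_mul_cancel s
    rw [← transGL_inv, hss]
    simp only [mul_assoc]
    rw [← mul_assoc s s, hss', one_mul, inv_mul_cancel, mul_one]
  rw [h, map_mul, mul_assoc]
  refine unitri_mem_stabilizer hv _ ?_
  by_cases ha0 : a = 0
  · rw [ha0, transGL_zero, mul_one, hs, permGL_mul_steinbergElement]
    refine Submodule.smul_mem _ _ ?_
    exact steinbergElement_mem_unitriSpan
  · rw [swap_mul_transGL_mul_steinbergElement _ ha0]
    refine sub_mem (mul_mem_unitriSpan (transGL_mem_unitri hlt _)) ?_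
    exact steinbergElement_mem_unitriSpan

theorem permGL_mem_stabilizer (σ : Equiv.Perm (Fin n)) :
    permGL F σ ∈ unitriSpanStabilizer n F R := by
  obtain _ | m := n
  · rw [Subsingleton.elim σ 1, permGL_one]
    exact one_mem _
  · have h : σ ∈ Submonoid.closure (Set.range fun i : Fin m => Equiv.swap i.castSucc i.succ) := by
      rw [Equiv.Perm.mclosure_swap_castSucc_succ]
      trivial
    induction h using Submonoid.closure_induction with
    | mem x hx =>
      obtain ⟨i, rfl⟩ := hx
      exact swap_mem_stabilizer (by simp)
    | one => rw [permGL_one]; exact one_mem _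
    | mul x y _ _ hx hy => rw [permGL_mul]; exact mul_mem hx hy

theorem transGL_mem_stabilizer {i j : Fin n} (h : i ≠ j) (c : F) :
    transGL h c ∈ unitriSpanStabilizer n F R := by
  rcases lt_or_gt_of_ne h with hlt | hlt
  · exact unitri_mem_stabilizer (transGL_mem_unitri hlt c)
  · have h1 := permGL_conj_transGL h c (Equiv.swap i j)
    have h2 : transGL ((Equiv.swap i j)⁻¹.injective.ne h) c = transGL h.symm c := by
      congr 1 <;> simp
    have h3 : transGL h c = permGL F (Equiv.swap i j) * transGL h.symm c *
        permGL F (Equiv.swap i j)⁻¹ := by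
      rw [← h2, ← h1, ← permGL_inv]
      group
    rw [h3]
    exact mul_mem (mul_mem (permGL_mem_stabilizer _)
      (unitri_mem_stabilizer (transGL_mem_unitri hlt c))) (permGL_mem_stabilizer _)

/-- Gaussian elimination writes g as a product of diagonal matrices and transvections, all of which
stabilize the span. -/
theorem mem_stabilizer (g : GL (Fin n) F) : g ∈ unitriSpanStabilizer n F R := by
  refine Matrix.diagonal_transvection_induction_of_det_ne_zero
    (fun A => ∀ g : GL (Fin n) F, (g : Matrix (Fin n) (Fin n) F) = A →
      g ∈ unitriSpanStabilizer n F R) (g : Matrix (Fin n) (Fin n) F) ?_ ?_ ?_ ?_ g rfl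
  · exact ((Matrix.isUnit_iff_isUnit_det _).1 g.isUnit).ne_zero
  · intro D _ g hg
    refine diagonal_mem_stabilizer fun a b hab => ?_
    rw [hg, Matrix.diagonal_apply_ne _ hab]
  · intro t g hg
    have : g = transGL t.hij t.c := Units.ext hg
    rw [this]
    exact transGL_mem_stabilizer _ _
  · intro A B hA hB ihA ihB g hg
    have : g = Matrix.GeneralLinearGroup.mkOfDetNeZero A hA *
        Matrix.GeneralLinearGroup.mkOfDetNeZero B hB := Units.ext hg
    rw [this]
    exact mul_mem (ihA _ rfl) (ihB _ rfl)

/-- The Steinberg lattice is spanned by the `U`-translates of its generator. -/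
theorem mem_unitriSpan_of_mem_lattice {x : R[GL (Fin n) F]} (hx : x ∈ lattice n F R) :
    x ∈ unitriSpan n F R := by
  obtain ⟨a, rfl⟩ := Ideal.mem_span_singleton'.1 hx
  have he : steinbergElement n F R ∈ unitriSpan n F R := by
    exact steinbergElement_mem_unitriSpan
  induction a using MonoidAlgebra.induction_linear with
  | zero => simp
  | add a b ha hb =>
    rw [add_mul]
    exact add_mem (ha (Ideal.mul_mem_left _ _ (Ideal.mem_span_singleton_self _)))
      (hb (Ideal.mul_mem_left _ _ (Ideal.mem_span_singleton_self _)))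
  | single g r =>
    have : (MonoidAlgebra.single g r : R[GL (Fin n) F]) = r • MonoidAlgebra.of R _ g := by simp
    rw [this, smul_mul_assoc]
    exact Submodule.smul_mem _ _ (mem_stabilizer g _ he)

theorem lattice_le_span : (⊤ : Submodule R (lattice n F R)) ≤
    Submodule.span R (Set.range fun u : unitri n F =>
      MonoidAlgebra.of R _ (u : GL (Fin n) F) • gen n F R) := by
  rintro ⟨x, hx⟩ -
  have h := mem_unitriSpan_of_mem_lattice hx
  have hmap : unitriSpan n F R = (Submodule.span R (Set.range fun u : unitri n F =>
      MonoidAlgebra.of R _ (u : GL (Fin n) F) • gen n F R)).map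
        ((lattice n F R).subtype.restrictScalars R) := by
    rw [Submodule.map_span, ← Set.range_comp]
    rfl
  rw [hmap] at h
  obtain ⟨y, hy, hyx⟩ := h
  have : y = ⟨x, hx⟩ := Subtype.ext hyx
  rwa [← this]

end Spanning

/-! ### Projections onto the linear characters of U. -/

section Eigenvectors

variable {n : ℕ} {F : Type*} [Field F] {k : Type*} [CommRing k]
  {Q : Type*} [AddCommGroup Q] [Module k Q] [Module k[GL (Fin n) F] Q]
  [IsScalarTower k k[GL (Fin n) F] Q]

/-- `x` spans a `U`-stable line on which `U` acts through the linear character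
`u ↦ ψ (∑ ε_i u_{i,i+1})`. -/
def IsEigen (ψ : AddChar F k) (ε : Fin n → F) (x : Q) : Prop :=
  ∀ u ∈ unitri n F, MonoidAlgebra.of k _ u • x = ψ (superdiag ε u) • x

variable [Fintype (unitri n F)]

variable (k Q) in
/-- The unnormalised projection onto the vectors on which `U` acts through the linear character
`u ↦ ψ (∑ ε_i u_{i,i+1})`. -/
def eigenSum (ψ : AddChar F k) (ε : Fin n → F) : Q →ₗ[k] Q :=
  ∑ u : unitri n F, ψ (-superdiag ε (u : GL (Fin n) F)) •
    Algebra.lsmul k k Q (MonoidAlgebra.of k _ (u : GL (Fin n) F))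

theorem eigenSum_apply (ψ : AddChar F k) (ε : Fin n → F) (x : Q) :
    eigenSum k Q ψ ε x = ∑ u : unitri n F, ψ (-superdiag ε (u : GL (Fin n) F)) •
      MonoidAlgebra.of k _ (u : GL (Fin n) F) • x := by
  simp [eigenSum]

theorem of_smul_eigenSum (ψ : AddChar F k) (ε : Fin n → F) {v : GL (Fin n) F}
    (hv : v ∈ unitri n F) (x : Q) :
    MonoidAlgebra.of k _ v • eigenSum k Q ψ ε x =
      ψ (superdiag ε v) • eigenSum k Q ψ ε x := by
  rw [eigenSum_apply, Finset.smul_sum, Finset.smul_sum]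
  refine Fintype.sum_equiv (Equiv.mulLeft ⟨v, hv⟩) _ _ fun u => ?_
  rw [smul_algebra_smul_comm, ← mul_smul, ← map_mul, smul_smul, ← AddChar.map_add_eq_mul,
    Equiv.coe_mulLeft, Subgroup.coe_mul, superdiag_mul ε hv u.2]
  congr 2
  ring

theorem isEigen_eigenSum (ψ : AddChar F k) (ε : Fin n → F) (x : Q) :
    IsEigen ψ ε (eigenSum k Q ψ ε x) := fun _ hu => of_smul_eigenSum ψ ε hu x

theorem eigenSum_of_smul (ψ : AddChar F k) (ε : Fin n → F) {v : GL (Fin n) F}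
    (hv : v ∈ unitri n F) (x : Q) :
    eigenSum k Q ψ ε (MonoidAlgebra.of k _ v • x) =
      ψ (superdiag ε v) • eigenSum k Q ψ ε x := by
  rw [eigenSum_apply, eigenSum_apply, Finset.smul_sum]
  refine Fintype.sum_equiv (Equiv.mulRight ⟨v, hv⟩) _ _ fun u => ?_
  rw [← mul_smul, ← map_mul, smul_smul, ← AddChar.map_add_eq_mul,
    Equiv.coe_mulRight, Subgroup.coe_mul, superdiag_mul ε u.2 hv]
  congr 2
  ring

theorem eigenSum_of_isEigen {ψ : AddChar F k} {ε : Fin n → F} {x : Q} (hx : IsEigen ψ ε x) :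
    eigenSum k Q ψ ε x = (Nat.card (unitri n F) : k) • x := by
  rw [eigenSum_apply, Finset.sum_congr rfl (g := fun _ => x)]
  · simp [Nat.cast_smul_eq_nsmul]
  · intro u _
    rw [hx u u.2, smul_smul, ← AddChar.map_add_eq_mul, neg_add_cancel, AddChar.map_zero_eq_one,
      one_smul]

theorem eigenSum_mem (ψ : AddChar F k) (ε : Fin n → F) {N : Submodule k[GL (Fin n) F] Q} {x : Q}
    (hx : x ∈ N) : eigenSum k Q ψ ε x ∈ N := by
  rw [eigenSum_apply]
  exact Submodule.sum_mem _ fun u _ => N.smul_of_tower_mem _ (N.smul_mem _ hx)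

end Eigenvectors

/-! ### Multiplicity one in L, detected by the coefficient at w₀. -/

section Coefficients

variable {n : ℕ} {F : Type*} [Field F] [Finite F] {R : Type*} [CommRing R] {ℓ : ℕ}

theorem toReduction_surjective : Function.Surjective (toReduction n F R ℓ) :=
  Submodule.Quotient.mk_surjective _

theorem of_smul_toReduction (g : GL (Fin n) F) (x : lattice n F R) :
    MonoidAlgebra.of (ResField R ℓ) _ g • toReduction n F R ℓ x =
      toReduction n F R ℓ (MonoidAlgebra.of R _ g • x) :=
  single_smul_toReduction n F R ℓ g 1 x

theorem smul_toReduction (r : R) (x : lattice n F R) :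
    (Ideal.Quotient.mk _ r : ResField R ℓ) • toReduction n F R ℓ x =
      toReduction n F R ℓ (r • x) := rfl

variable (n F R ℓ) in
/-- The coefficient of `g` in an element of the Steinberg lattice, modulo `ℓ`. -/
def latticeCoeff (g : GL (Fin n) F) : lattice n F R →ₗ[R] ResField R ℓ where
  toFun x := Ideal.Quotient.mk _ ((x : R[GL (Fin n) F]).coeff g)
  map_add' x y := by simp
  map_smul' r x := by simp [Algebra.smul_def]

variable (n F R ℓ) in
/-- The coefficient of `g` in an element of `L = I/ℓI`. -/
def redCoeff (g : GL (Fin n) F) : Reduction n F R ℓ →+ ResField R ℓ :=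
  (Submodule.liftQ (Ideal.span {(ℓ : R)} • ⊤ : Submodule R (lattice n F R))
    (latticeCoeff n F R ℓ g) (by
      rw [Submodule.smul_le]
      intro r hr x _
      rw [LinearMap.mem_ker, map_smul, Algebra.smul_def]
      have : (algebraMap R (ResField R ℓ)) r = 0 := Ideal.Quotient.eq_zero_iff_mem.2 hr
      rw [this, zero_mul])).toAddMonoidHom

theorem redCoeff_toReduction (g : GL (Fin n) F) (x : lattice n F R) :
    redCoeff n F R ℓ g (toReduction n F R ℓ x) =
      Ideal.Quotient.mk _ ((x : R[GL (Fin n) F]).coeff g) := rfl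

theorem redCoeff_smul (g : GL (Fin n) F) (c : ResField R ℓ) (x : Reduction n F R ℓ) :
    redCoeff n F R ℓ g (c • x) = c * redCoeff n F R ℓ g x := by
  obtain ⟨r, rfl⟩ := Ideal.Quotient.mk_surjective c
  obtain ⟨x, rfl⟩ := toReduction_surjective x
  rw [smul_toReduction, redCoeff_toReduction, redCoeff_toReduction, ← map_mul]
  rfl

theorem redCoeff_of_smul (g h : GL (Fin n) F) (x : Reduction n F R ℓ) :
    redCoeff n F R ℓ g (MonoidAlgebra.of (ResField R ℓ) _ h • x) = redCoeff n F R ℓ (h⁻¹ * g) x := by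
  obtain ⟨x, rfl⟩ := toReduction_surjective x
  rw [of_smul_toReduction, redCoeff_toReduction, redCoeff_toReduction]
  congr 1
  simp [MonoidAlgebra.coeff_single_mul_apply]

theorem redCoeff_mul_borel (g : GL (Fin n) F) {b : GL (Fin n) F} (hb : b ∈ borel n F)
    (x : Reduction n F R ℓ) :
    redCoeff n F R ℓ (g * b) x = redCoeff n F R ℓ g x := by
  obtain ⟨x, rfl⟩ := toReduction_surjective x
  rw [redCoeff_toReduction, redCoeff_toReduction, coeff_mul_borel n F R _ x.2 _ _ hb]

/-- Conjugation by w₀ takes U to the lower unitriangular group, which meets B trivially. -/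
theorem coeff_steinbergElement_rev {u : GL (Fin n) F} (hu : u ∈ unitri n F) (hu1 : u ≠ 1) :
    (steinbergElement n F R).coeff (u * permGL F Fin.revPerm) = 0 := by
  classical
  rw [coeff_steinbergElement hu, if_neg]
  intro h
  refine hu1 (Units.ext (Matrix.ext fun i j => ?_))
  rcases lt_trichotomy i j with hij | rfl | hij
  · have := h (Fin.rev i) (Fin.rev j) (Fin.rev_lt_rev.2 hij)
    rw [permGL_inv_mul_mul_apply] at this
    simpa [hij.ne] using this
  · simp [unitri_apply_self hu]
  · simp [unitri_apply_of_lt hu hij, hij.ne']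

theorem coeff_steinbergElement_rev_one :
    (steinbergElement n F R).coeff (permGL F Fin.revPerm) =
      ((Equiv.Perm.sign (Fin.revPerm : Equiv.Perm (Fin n)) : ℤ) : R) := by
  classical
  have h := coeff_steinbergElement (R := R) (one_mem (unitri n F)) Fin.revPerm
  rw [one_mul, mul_one, inv_mul_cancel, if_pos (one_mem _)] at h
  exact h

variable [Fintype (unitri n F)]

/-- Only the term u = 1 contributes, so the coefficient is ±1 and the projection of the generator is
not zero. -/
theorem redCoeff_eigenSum_gen (ψ : AddChar F (ResField R ℓ)) (ε : Fin n → F) :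
    redCoeff n F R ℓ (permGL F Fin.revPerm)
      (eigenSum _ _ ψ ε (toReduction n F R ℓ (gen n F R))) =
        ((Equiv.Perm.sign (Fin.revPerm : Equiv.Perm (Fin n)) : ℤ) : ResField R ℓ) := by
  rw [eigenSum_apply, map_sum, Finset.sum_eq_single 1]
  · rw [redCoeff_smul, redCoeff_of_smul, redCoeff_toReduction, gen, OneMemClass.coe_one,
      superdiag_one, inv_one, one_mul, coeff_steinbergElement_rev_one]
    simp
  · intro u _ hu
    rw [redCoeff_smul, redCoeff_of_smul, redCoeff_toReduction, gen,
      coeff_steinbergElement_rev (inv_mem u.2) (by simpa using hu), map_zero, mul_zero]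
  · simp

/-- The projection sends each U-translate of the generator to a multiple of one vector, and these
translates span. -/
theorem exists_eigenSum_eq_smul (ψ : AddChar F (ResField R ℓ)) (ε : Fin n → F)
    (x : Reduction n F R ℓ) :
    ∃ c : ResField R ℓ, eigenSum _ _ ψ ε x =
      c • eigenSum _ _ ψ ε (toReduction n F R ℓ (gen n F R)) := by
  obtain ⟨x, rfl⟩ := toReduction_surjective x
  have hx := lattice_le_span (Submodule.mem_top (x := x))
  induction hx using Submodule.span_induction with
  | mem x hx =>
    obtain ⟨u, rfl⟩ := hx
    exact ⟨ψ (superdiag ε (u : GL (Fin n) F)), by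
      rw [← of_smul_toReduction, eigenSum_of_smul _ _ u.2]⟩
  | zero => exact ⟨0, by simp⟩
  | add x y _ _ hx hy =>
    obtain ⟨a, ha⟩ := hx
    obtain ⟨b, hb⟩ := hy
    exact ⟨a + b, by rw [map_add, map_add, ha, hb, add_smul]⟩
  | smul r x _ hx =>
    obtain ⟨a, ha⟩ := hx
    exact ⟨Ideal.Quotient.mk _ r * a, by rw [← smul_toReduction, map_smul, ha, mul_smul]⟩

/-- An eigenvector of `U` in `L` is determined by one of its coefficients. -/
theorem IsEigen.eq_zero (hU : IsUnit (Nat.card (unitri n F) : ResField R ℓ))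
    {ψ : AddChar F (ResField R ℓ)} {ε : Fin n → F} {x : Reduction n F R ℓ} (hx : IsEigen ψ ε x)
    (h0 : redCoeff n F R ℓ (permGL F Fin.revPerm) x = 0) : x = 0 := by
  obtain ⟨c, hc⟩ := exists_eigenSum_eq_smul ψ ε x
  have h := congrArg (redCoeff n F R ℓ (permGL F Fin.revPerm)) hc
  -- Now |U| x = c · (projection of the generator); comparing coefficients at w₀ gives 0 = ±c.
  rw [eigenSum_of_isEigen hx] at hc
  rw [eigenSum_of_isEigen hx, redCoeff_smul, h0, mul_zero, redCoeff_smul,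
    redCoeff_eigenSum_gen] at h
  have hc0 : c = 0 := by
    rcases Int.units_eq_one_or (Equiv.Perm.sign (Fin.revPerm : Equiv.Perm (Fin n))) with hs | hs <;>
      simpa [hs] using h.symm
  rw [hc0, zero_smul] at hc
  exact hU.smul_eq_zero.1 hc

/-- The eigenvectors of `U` in `L` for a linear character form a line. -/
theorem IsEigen.exists_smul (hU : IsUnit (Nat.card (unitri n F) : ResField R ℓ))
    {ψ : AddChar F (ResField R ℓ)} {ε : Fin n → F} {x y : Reduction n F R ℓ} (hx : IsEigen ψ ε x)
    (hy : IsEigen ψ ε y) (h0 : IsUnit (redCoeff n F R ℓ (permGL F Fin.revPerm) x)) :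
    ∃ c : ResField R ℓ, y = c • x := by
  obtain ⟨c, hc⟩ := h0
  refine ⟨redCoeff n F R ℓ (permGL F Fin.revPerm) y * ↑c⁻¹, ?_⟩
  rw [← sub_eq_zero]
  refine IsEigen.eq_zero (ψ := ψ) (ε := ε) hU (fun u hu => ?_) ?_
  · rw [smul_sub, smul_algebra_smul_comm, hx u hu, hy u hu, smul_sub, smul_comm]
  · rw [map_sub, redCoeff_smul, ← hc, mul_assoc, Units.inv_mul, mul_one, sub_self]

end Coefficients

/-! ### The permutation exchanging two consecutive blocks. -/

section Rotation

variable {n : ℕ}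

/-- The permutation of `0, …, n-1` that interchanges the blocks `0, …, j` and `j+1, …, n-1`,
preserving the order in each of them. -/
def blockRotate (j : Fin n) : Equiv.Perm (Fin n) where
  -- The remainder only supplies the bound: for i ≤ j the sum is already less than n.
  toFun i := if i ≤ j then ⟨(i + (n - 1 - j)) % n, Nat.mod_lt _ j.pos⟩
    else ⟨i - (j + 1), by omega⟩
  invFun i := if h : (i : ℕ) + j + 1 < n then ⟨i + j + 1, h⟩ else ⟨i - (n - 1 - j), by omega⟩
  left_inv i := by
    have := i.2
    have := j.2
    by_cases h : (i : ℕ) ≤ j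
    · have h1 : (i + (n - 1 - j) : ℕ) % n = i + (n - 1 - j) := Nat.mod_eq_of_lt (by omega)
      ext
      simp only [Fin.le_def, h, if_true, h1]
      rw [dif_neg (by omega)]
      simp
    · ext
      simp only [Fin.le_def, h, if_false]
      rw [dif_pos (by omega)]
      simp only
      omega
  right_inv i := by
    have := i.2
    have := j.2
    by_cases h : (i : ℕ) + j + 1 < n
    · ext
      simp only [h, dif_pos, Fin.le_def]
      rw [if_neg (by omega)]
      simp only
      omega
    · ext
      have h1 : (i - (n - 1 - j) + (n - 1 - j) : ℕ) % n = i := by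
        rw [Nat.sub_add_cancel (by omega), Nat.mod_eq_of_lt i.2]
      simp only [dif_neg h, Fin.le_def]
      rw [if_pos (by omega)]
      exact h1

theorem blockRotate_of_le {i j : Fin n} (h : i ≤ j) :
    (blockRotate j i : ℕ) = i + (n - 1 - j) := by
  have := i.2
  have := j.2
  rw [Fin.le_def] at h
  simp only [blockRotate, Equiv.coe_fn_mk, Fin.le_def, h, if_true]
  exact Nat.mod_eq_of_lt (by omega)

theorem blockRotate_of_lt {i j : Fin n} (h : j < i) :
    (blockRotate j i : ℕ) = i - (j + 1) := by
  simp [blockRotate, not_le.2 h]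

end Rotation

/-! ### Block-diagonal part and unipotent radical under the rotation. -/

section Factorisation

variable {n : ℕ} {F : Type*} [Field F]

/-- The diagonal blocks of a matrix, with respect to the blocks `0, …, j` and `j+1, …, n-1`. -/
def diagBlocks (j : Fin n) (A : Matrix (Fin n) (Fin n) F) : Matrix (Fin n) (Fin n) F :=
  Matrix.of fun a b => if (a ≤ j ↔ b ≤ j) then A a b else 0

theorem diagBlocks_apply (j : Fin n) (A : Matrix (Fin n) (Fin n) F) (a b : Fin n) :
    diagBlocks j A a b = if (a ≤ j ↔ b ≤ j) then A a b else 0 := rfl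

/-- The diagonal blocks of an upper unitriangular matrix. -/
def diagBlocksGL (j : Fin n) {v : GL (Fin n) F} (hv : v ∈ unitri n F) : GL (Fin n) F :=
  mkUnitri (diagBlocks j v)
    (fun a b hab => by rw [diagBlocks_apply, unitri_apply_of_lt hv hab, ite_self])
    (fun a => by rw [diagBlocks_apply, if_pos Iff.rfl, hv.2])

theorem diagBlocksGL_apply (j : Fin n) {v : GL (Fin n) F} (hv : v ∈ unitri n F) (a b : Fin n) :
    (diagBlocksGL j hv : Matrix (Fin n) (Fin n) F) a b =
      if (a ≤ j ↔ b ≤ j) then (v : Matrix (Fin n) (Fin n) F) a b else 0 := rfl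

theorem diagBlocksGL_mem (j : Fin n) {v : GL (Fin n) F} (hv : v ∈ unitri n F) :
    diagBlocksGL j hv ∈ unitri n F := mkUnitri_mem _ _ _

/-- This places v⁻¹ times the block-diagonal part of v in the unipotent radical. Inside a diagonal
block its entries are computed by the same terms as those of v⁻¹v = 1. -/
theorem inv_mul_diagBlocksGL_apply (j : Fin n) {v : GL (Fin n) F} (hv : v ∈ unitri n F)
    {a b : Fin n} (hab : a ≤ j ↔ b ≤ j) (hne : a ≠ b) :
    ((v⁻¹ * diagBlocksGL j hv : GL (Fin n) F) : Matrix (Fin n) (Fin n) F) a b = 0 := by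
  have h1 : ((v⁻¹ * v : GL (Fin n) F) : Matrix (Fin n) (Fin n) F) a b = 0 := by
    rw [inv_mul_cancel, Units.val_one, Matrix.one_apply_ne hne]
  rw [← h1, Units.val_mul, Units.val_mul, Matrix.mul_apply, Matrix.mul_apply]
  refine Finset.sum_congr rfl fun e _ => ?_
  rw [diagBlocksGL_apply]
  split_ifs with he
  · rfl
  · by_cases haj : a ≤ j
    · rw [unitri_apply_of_lt hv, mul_zero]
      have hbj := hab.1 haj
      exact lt_of_le_of_lt hbj (not_le.1 fun h => he (iff_of_true h hbj))
    · have hbj : ¬ b ≤ j := fun h => haj (hab.2 h)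
      rw [unitri_apply_of_lt (inv_mem hv), zero_mul, zero_mul]
      have hej : e ≤ j := by
        by_contra h
        exact he (iff_of_false h hbj)
      exact lt_of_le_of_lt hej (not_le.1 haj)

/-- The rotation preserves the order inside each block. -/
theorem conj_diagBlocksGL_mem (j : Fin n) {v : GL (Fin n) F} (hv : v ∈ unitri n F) :
    (permGL F (blockRotate j)⁻¹)⁻¹ * diagBlocksGL j hv * permGL F (blockRotate j)⁻¹ ∈
      unitri n F := by
  refine ⟨fun a b hab => ?_, fun a => ?_⟩
  · rw [permGL_inv_mul_mul_apply]
    obtain ⟨i, rfl⟩ := (blockRotate j).surjective a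
    obtain ⟨i', rfl⟩ := (blockRotate j).surjective b
    simp only [Equiv.Perm.inv_def, Equiv.symm_apply_apply]
    rw [diagBlocksGL_apply]
    split_ifs with h
    · apply unitri_apply_of_lt hv
      rw [Fin.lt_def] at hab ⊢
      by_cases hi : i ≤ j
      · rw [blockRotate_of_le hi, blockRotate_of_le (h.1 hi)] at hab
        omega
      · have hi' : ¬ i' ≤ j := fun h' => hi (h.2 h')
        rw [blockRotate_of_lt (not_le.1 hi), blockRotate_of_lt (not_le.1 hi')] at hab
        omega
    · rfl
  · rw [permGL_inv_mul_mul_apply, (diagBlocksGL_mem j hv).2]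

/-- Since ε j = 0, the form ignores the one superdiagonal entry outside the diagonal blocks. After
rotation the entry at the new junction is zero, so the value of η there does not matter. -/
theorem superdiag_conj_diagBlocksGL {j : Fin n} {ε η : Fin n → F} (hj : ε j = 0)
    (hη : ∀ i, i ≠ j → η (blockRotate j i) = ε i) {v : GL (Fin n) F} (hv : v ∈ unitri n F) :
    superdiag η ((permGL F (blockRotate j)⁻¹)⁻¹ * diagBlocksGL j hv *
      permGL F (blockRotate j)⁻¹ : GL (Fin n) F) = superdiag ε v := by
  rw [superdiag, superdiag, ← Equiv.sum_comp (blockRotate j)]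
  refine Finset.sum_congr rfl fun i _ => ?_
  rw [← Equiv.sum_comp (blockRotate j)]
  refine Finset.sum_congr rfl fun i' _ => ?_
  rw [permGL_inv_mul_mul_apply]
  simp only [Equiv.Perm.inv_def, Equiv.symm_apply_apply]
  rw [diagBlocksGL_apply]
  have hi := i.2
  have hi' := i'.2
  by_cases h : i ≤ j ↔ i' ≤ j
  · rw [if_pos h]
    have hiff : ((blockRotate j i' : ℕ) = blockRotate j i + 1) ↔ ((i' : ℕ) = i + 1) := by
      by_cases hij : i ≤ j
      · rw [blockRotate_of_le hij, blockRotate_of_le (h.1 hij)]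
        omega
      · have hij' : ¬ i' ≤ j := fun h' => hij (h.2 h')
        rw [blockRotate_of_lt (not_le.1 hij), blockRotate_of_lt (not_le.1 hij')]
        rw [Fin.le_def] at hij hij'
        omega
    simp only [hiff]
    split_ifs with hs
    · rw [hη]
      rintro rfl
      have := h.1 le_rfl
      rw [Fin.le_def] at this
      omega
    · rfl
  · rw [if_neg h, mul_zero, ite_self]
    split_ifs with hs
    · have : i = j := by
        simp only [Fin.le_def] at h
        ext
        omega
      rw [this, hj, zero_mul]
    · rfl

/-- The rotation moves the unipotent radical below the diagonal, and w₀ brings it back above. -/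
theorem conj_inv_mul_diagBlocksGL_mem (j : Fin n) {v : GL (Fin n) F} (hv : v ∈ unitri n F) :
    (permGL F Fin.revPerm)⁻¹ * ((permGL F (blockRotate j)⁻¹)⁻¹ *
      (v⁻¹ * diagBlocksGL j hv) * permGL F (blockRotate j)⁻¹) * permGL F Fin.revPerm ∈
      borel n F := by
  intro a b hab
  rw [permGL_inv_mul_mul_apply, permGL_inv_mul_mul_apply]
  have hab' : Fin.revPerm a < Fin.revPerm b := Fin.rev_lt_rev.2 hab
  obtain ⟨i, hi⟩ := (blockRotate j).surjective (Fin.revPerm a)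
  obtain ⟨i', hi'⟩ := (blockRotate j).surjective (Fin.revPerm b)
  rw [← hi, ← hi'] at hab' ⊢
  simp only [Equiv.Perm.inv_def, Equiv.symm_apply_apply]
  by_cases h : i ≤ j ↔ i' ≤ j
  · refine inv_mul_diagBlocksGL_apply j hv h ?_
    rintro rfl
    exact lt_irrefl _ hab'
  · apply unitri_apply_of_lt (mul_mem (inv_mem hv) (diagBlocksGL_mem j hv))
    have h1 := i.2
    have h2 := i'.2
    have h3 := j.2
    by_cases hij : i ≤ j
    · have hij' : ¬ i' ≤ j := fun h' => h (iff_of_true hij h')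
      rw [Fin.lt_def, blockRotate_of_le hij, blockRotate_of_lt (not_le.1 hij')] at hab'
      omega
    · have hij' : i' ≤ j := by
        by_contra h'
        exact h (iff_of_false hij h')
      exact lt_of_le_of_lt hij' (not_le.1 hij)

end Factorisation

/-! ### From the regular character to all characters with ε_i in {0, 1}. -/

section Transfer

variable {n : ℕ} {F : Type*} [Field F] [Finite F] {R : Type*} [CommRing R] {ℓ : ℕ}
  [Fintype (unitri n F)]

/-- All |U| terms of the projection contribute equally. Factor u⁻¹ into its block-diagonal part and
a radical part: the first acts on x through η and cancels the factor ψ(-∑ ε_i u_{i,i+1}), the second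
is absorbed by B to the right of w₀. -/
theorem redCoeff_eigenSum_blockRotate {ψ : AddChar F (ResField R ℓ)} {j : Fin n}
    {ε η : Fin n → F} (hj : ε j = 0) (hη : ∀ i, i ≠ j → η (blockRotate j i) = ε i)
    {x : Reduction n F R ℓ} (hx : IsEigen ψ η x) :
    redCoeff n F R ℓ (permGL F (blockRotate j)⁻¹ * permGL F Fin.revPerm)
      (eigenSum _ _ ψ ε (MonoidAlgebra.of (ResField R ℓ) _ (permGL F (blockRotate j)⁻¹) • x)) =
        (Nat.card (unitri n F) : ResField R ℓ) * redCoeff n F R ℓ (permGL F Fin.revPerm) x := by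
  set s := permGL F (blockRotate j)⁻¹ with hs
  set w := permGL F (Fin.revPerm : Equiv.Perm (Fin n)) with hw
  rw [eigenSum_apply, map_sum, Finset.sum_congr rfl (g := fun _ => redCoeff n F R ℓ w x)]
  · simp
  rintro ⟨u, hu⟩ -
  have hv := inv_mem hu
  set l := diagBlocksGL j hv with hl
  have h1 := conj_diagBlocksGL_mem j hv
  have h2 := superdiag_conj_diagBlocksGL hj hη hv
  have h3 := inv_mem (conj_inv_mul_diagBlocksGL_mem j hv)
  rw [← hs, ← hl] at h1 h2 h3
  rw [← hw] at h3
  have h4 : (u * s)⁻¹ * (s * w) =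
      s⁻¹ * l * s * (w * (w⁻¹ * (s⁻¹ * (u⁻¹⁻¹ * l) * s) * w)⁻¹) := by
    group
  rw [redCoeff_smul, ← mul_smul, ← map_mul, redCoeff_of_smul]
  dsimp only
  rw [h4]
  have h5 : redCoeff n F R ℓ
      (s⁻¹ * l * s * (w * (w⁻¹ * (s⁻¹ * (u⁻¹⁻¹ * l) * s) * w)⁻¹)) x =
      redCoeff n F R ℓ (w * (w⁻¹ * (s⁻¹ * (u⁻¹⁻¹ * l) * s) * w)⁻¹)
        (MonoidAlgebra.of (ResField R ℓ) _ (s⁻¹ * l * s)⁻¹ • x) := by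
    rw [redCoeff_of_smul, inv_inv (s⁻¹ * l * s)]
  rw [h5, redCoeff_mul_borel _ h3, hx _ (inv_mem h1), redCoeff_smul, superdiag_inv _ h1, h2,
    superdiag_inv _ hu, ← mul_assoc, ← AddChar.map_add_eq_mul, neg_neg, neg_add_cancel,
    AddChar.map_zero_eq_one, one_mul]

/-- A submodule of `L` that contains an eigenvector of `U` for a character in general position
contains one for every character `∑ ε_i u_{i,i+1}` with `ε_i ∈ {0, 1}`. -/
theorem exists_isEigen_of_regular (hU : IsUnit (Nat.card (unitri n F) : ResField R ℓ))
    {ψ : AddChar F (ResField R ℓ)}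
    {N : Submodule (ResField R ℓ)[GL (Fin n) F] (Reduction n F R ℓ)}
    {x : Reduction n F R ℓ} (hxN : x ∈ N) (hx0 : x ≠ 0) (hx : IsEigen (n := n) ψ (fun _ => 1) x)
    (ε : Fin n → F) (hε : ∀ i, ε i = 0 ∨ ε i = 1) :
    ∃ y : Reduction n F R ℓ, y ∈ N ∧ y ≠ 0 ∧ IsEigen (n := n) ψ ε y := by
  classical
  -- Induction on the number of zeros of ε. The last index is counted too, although `superdiag`
  -- ignores it.
  generalize hm : (Finset.univ.filter fun i => ε i = 0).card = m
  induction m generalizing ε with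
  | zero =>
    have : ε = fun _ => 1 := by
      funext i
      rw [Finset.card_eq_zero, Finset.filter_eq_empty_iff] at hm
      exact (hε i).resolve_left (hm (Finset.mem_univ i))
    rw [this]
    exact ⟨x, hxN, hx0, hx⟩
  | succ m ih =>
    obtain ⟨j, hj⟩ : (Finset.univ.filter fun i => ε i = 0).Nonempty := by
      rw [← Finset.card_pos]; omega
    have hj0 : ε j = 0 := (Finset.mem_filter.1 hj).2
    -- This is ε rotated, with its zero at j replaced by a 1. That 1 sits at `blockRotate j j`, the
    -- last index.
    set η : Fin n → F := fun a => if a = blockRotate j j then 1 else ε ((blockRotate j)⁻¹ a)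
      with hη
    have hη1 : ∀ i, i ≠ j → η (blockRotate j i) = ε i := by
      intro i hi
      simp [hη, hi]
    obtain ⟨y, hyN, hy0, hy⟩ := ih η (by
        intro i
        simp only [hη]
        split_ifs
        · exact Or.inr rfl
        · exact hε _) (by
      have : (Finset.univ.filter fun i => η i = 0) =
          ((Finset.univ.filter fun i => ε i = 0).erase j).map (blockRotate j).toEmbedding := by
        ext a
        obtain ⟨i, rfl⟩ := (blockRotate j).surjective a
        by_cases hi : i = j
        · simp [hη, hi]
        · simp [hη1 i hi, hi]
      rw [this, Finset.card_map, Finset.card_erase_of_mem hj, hm, Nat.add_sub_cancel])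
    have hc := redCoeff_eigenSum_blockRotate hj0 hη1 hy
    refine ⟨_, ?_, ?_, isEigen_eigenSum (Q := Reduction n F R ℓ) ψ ε
      (MonoidAlgebra.of (ResField R ℓ) _ (permGL F (blockRotate j)⁻¹) • y)⟩
    · exact eigenSum_mem ψ ε (N.smul_mem _ hyN)
    · intro h0
      rw [h0, map_zero, eq_comm, hU.mul_right_eq_zero] at hc
      exact hy0 (IsEigen.eq_zero hU hy hc)

end Transfer

/-! ### Fourier analysis on a finite vector space. -/

section Characters

/-- Some Fourier coefficient of a function that does not vanish at `0` is not zero. -/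
theorem exists_char_sum_ne_zero {ι F k V : Type*} [Fintype ι] [DecidableEq ι] [Field F] [Fintype F]
    [CommRing k] [IsDomain k] [AddCommGroup V] [Module k V] {ψ : AddChar F k} (hψ : ψ ≠ 1)
    (hF : IsUnit (Fintype.card F : k)) (T : (ι → F) → V) (hT : T 0 ≠ 0) :
    ∃ c : ι → F, ∑ a, ψ (-∑ i, c i * a i) • T a ≠ 0 := by
  by_contra! h
  -- By orthogonality this sum of all Fourier coefficients is also |F| ^ |ι| times T 0, as in
  -- Fourier inversion at 0.
  have h1 : ∑ c : ι → F, ∑ a, ψ (-∑ i, c i * a i) • T a = 0 := by simp [h]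
  rw [Finset.sum_comm, Finset.sum_eq_single 0] at h1
  · simp only [Pi.zero_apply, mul_zero, Finset.sum_const_zero, neg_zero, AddChar.map_zero_eq_one,
      one_smul, Finset.sum_const, Finset.card_univ, Fintype.card_fun] at h1
    rw [← Nat.cast_smul_eq_nsmul k, Nat.cast_pow] at h1
    exact hT ((hF.pow _).smul_eq_zero.1 h1)
  · intro a _ ha
    rw [← Finset.sum_smul]
    obtain ⟨i, hi⟩ := Function.ne_iff.1 ha
    obtain ⟨t, ht⟩ := AddChar.ne_one_iff.1 hψ
    let f : (ι → F) →+ F := AddMonoidHom.mk' (fun c => -∑ i, c i * a i) fun c c' => by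
      simp [add_mul, Finset.sum_add_distrib, add_comm]
    have h2 : ψ.compAddMonoidHom f ≠ 1 := by
      refine AddChar.ne_one_iff.2 ⟨Pi.single i (-t / a i), ?_⟩
      have : f (Pi.single i (-t / a i)) = t := by
        change -∑ i', _ = _
        rw [Finset.sum_eq_single i]
        · rw [Pi.single_eq_same, div_mul_cancel₀ _ hi, neg_neg]
        · intro b _ hb
          rw [Pi.single_eq_of_ne hb, zero_mul]
        · simp
      rw [AddChar.compAddMonoidHom_apply, this]
      exact ht
    have h3 := AddChar.sum_eq_zero_of_ne_one h2
    have h4 : ∑ c : ι → F, ψ (-∑ i, c i * a i) = 0 := h3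
    rw [h4, zero_smul]
  · simp

end Characters

/-! ### Subgroups of U supported in the last columns. -/

section Columns

variable {n : ℕ} {F : Type*} [Field F]

/-- The first `m` columns of `g` are those of the identity matrix. -/
def TrivialCols (m : ℕ) (g : GL (Fin n) F) : Prop :=
  ∀ p q : Fin n, (q : ℕ) < m → (g : Matrix (Fin n) (Fin n) F) p q = if p = q then 1 else 0

/-- The rows of `g` from row `j` on, and the columns after column `j`, are those of the identity
matrix. -/
def IsBlockId (j : Fin n) (g : GL (Fin n) F) : Prop :=
  ∀ p q : Fin n, j ≤ p ∨ j < q → (g : Matrix (Fin n) (Fin n) F) p q = if p = q then 1 else 0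

theorem isBlockId_one (j : Fin n) : IsBlockId j (1 : GL (Fin n) F) := fun p q _ => by
  rw [Units.val_one, Matrix.one_apply]

theorem mul_apply_of_row {A B : Matrix (Fin n) (Fin n) F} {p : Fin n}
    (hA : ∀ s, A p s = if p = s then 1 else 0) (q : Fin n) : (A * B) p q = B p q := by
  rw [Matrix.mul_apply]
  simp [hA]

theorem mul_apply_of_col {A B : Matrix (Fin n) (Fin n) F} {q : Fin n}
    (hB : ∀ s, B s q = if s = q then 1 else 0) (p : Fin n) : (A * B) p q = A p q := by
  rw [Matrix.mul_apply]
  simp [hB]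

theorem IsBlockId.inv {j : Fin n} {g : GL (Fin n) F} (hg : IsBlockId j g) : IsBlockId j g⁻¹ := by
  intro p q hpq
  rw [← Matrix.one_apply (α := F)]
  rcases hpq with h | h
  · rw [← mul_apply_of_row (B := ↑g⁻¹) (fun s => hg p s (Or.inl h)) q, ← Units.val_mul, mul_inv_cancel,
      Units.val_one]
  · rw [← mul_apply_of_col (A := ↑g⁻¹) (fun s => hg s q (Or.inr h)) p, ← Units.val_mul, inv_mul_cancel,
      Units.val_one]

section Conj

variable {j : Fin n} {g u : GL (Fin n) F}

/-- The element u fixes pointwise the span of the basis vectors 0, …, j, and g preserves that span.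
-/
theorem TrivialCols.conj (hg : IsBlockId j g) (hu : TrivialCols (j + 1) u) :
    TrivialCols (j + 1) (g⁻¹ * u * g) := by
  intro p q hq
  have h1 : ∀ r, ((u * g : GL (Fin n) F) : Matrix (Fin n) (Fin n) F) r q =
      (g : Matrix (Fin n) (Fin n) F) r q := by
    intro r
    rw [Units.val_mul, Matrix.mul_apply, Finset.sum_eq_single r]
    · by_cases hr : (r : ℕ) < j + 1
      · rw [hu r r hr, if_pos rfl, one_mul]
      · rw [hg r q (Or.inl (by rw [Fin.le_def]; omega)), if_neg, mul_zero]
        rintro rfl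
        exact hr hq
    · intro s _ hs
      by_cases hs' : (s : ℕ) < j + 1
      · rw [hu r s hs', if_neg hs.symm, zero_mul]
      · rw [hg s q (Or.inl (by rw [Fin.le_def]; omega)), if_neg, mul_zero]
        rintro rfl
        exact hs' hq
    · simp
  rw [mul_assoc, Units.val_mul, Matrix.mul_apply]
  simp only [h1]
  rw [← Matrix.mul_apply, ← Units.val_mul, inv_mul_cancel, Units.val_one, Matrix.one_apply]

theorem IsBlockId.conj_apply (hg : IsBlockId j g) {p q : Fin n} (hp : j ≤ p) (hq : j < q) :
    ((g⁻¹ * u * g : GL (Fin n) F) : Matrix (Fin n) (Fin n) F) p q =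
      (u : Matrix (Fin n) (Fin n) F) p q := by
  rw [Units.val_mul, mul_apply_of_col (fun s => hg s q (Or.inr hq)), Units.val_mul,
    mul_apply_of_row (fun s => hg.inv p s (Or.inl hp))]

theorem IsBlockId.conj_mem_unitri (hg : IsBlockId j g) (hu : u ∈ unitri n F)
    (hu' : TrivialCols (j + 1) u) : g⁻¹ * u * g ∈ unitri n F := by
  have h := hu'.conj hg
  constructor
  · intro p q hqp
    by_cases hq : (q : ℕ) < j + 1
    · rw [h p q hq, if_neg hqp.ne']
    · have hjq : j < q := by rw [Fin.lt_def]; omega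
      rw [hg.conj_apply (hjq.trans hqp).le hjq, unitri_apply_of_lt hu hqp]
  · intro p
    by_cases hp : (p : ℕ) < j + 1
    · rw [h p p hp, if_pos rfl]
    · have hjp : j < p := by rw [Fin.lt_def]; omega
      rw [hg.conj_apply hjp.le hjp, hu.2]

/-- Superdiagonal entries in columns up to j vanish on both sides; conjugation leaves the later ones
alone. -/
theorem IsBlockId.superdiag_conj (hg : IsBlockId j g) (ε : Fin n → F)
    (hu' : TrivialCols (j + 1) u) :
    superdiag ε (g⁻¹ * u * g : GL (Fin n) F) = superdiag ε u := by
  refine Finset.sum_congr rfl fun p _ => Finset.sum_congr rfl fun q _ => ?_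
  split_ifs with h
  · by_cases hq : (q : ℕ) < j + 1
    · rw [hu'.conj hg p q hq, hu' p q hq]
    · rw [hg.conj_apply (by rw [Fin.le_def]; omega) (by rw [Fin.lt_def]; omega)]
  · rfl

end Conj

/-- Extension by zero of a family indexed by the `i < j`. -/
def extendZero (j : Fin n) (b : {i : Fin n // i < j} → F) (p : Fin n) : F :=
  if h : p < j then b ⟨p, h⟩ else 0

theorem extendZero_of_le {j : Fin n} (b : {i : Fin n // i < j} → F) {p : Fin n} (h : j ≤ p) :
    extendZero j b p = 0 := dif_neg (not_lt.2 h)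

theorem extendZero_add (j : Fin n) (a b : {i : Fin n // i < j} → F) (p : Fin n) :
    extendZero j (a + b) p = extendZero j a p + extendZero j b p := by
  unfold extendZero
  split_ifs <;> simp

theorem sum_extendZero_mul (j : Fin n) (b : {i : Fin n // i < j} → F) (f : Fin n → F) :
    ∑ p, extendZero j b p * f p = ∑ i, b i * f i := by
  rw [← Fintype.sum_subtype_add_sum_subtype (fun p => p < j)]
  have h1 : ∑ p : {p // ¬ p < j}, extendZero j b p * f p = 0 :=
    Finset.sum_eq_zero fun p _ => by rw [extendZero_of_le _ (not_lt.1 p.2), zero_mul]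
  rw [h1, add_zero]
  exact Finset.sum_congr rfl fun p _ => by rw [extendZero, dif_pos p.2]

/-- The unitriangular matrix whose only nonzero entries off the diagonal are those in column `j`,
given by `b`. -/
def colVec (j : Fin n) (b : {i : Fin n // i < j} → F) : GL (Fin n) F :=
  mkUnitri (Matrix.of fun p q => (if p = q then 1 else 0) + if q = j then extendZero j b p else 0)
    (fun p q hqp => by
      rw [Matrix.of_apply, if_neg hqp.ne', zero_add]
      split_ifs with h
      · rw [extendZero_of_le _ (h ▸ hqp.le)]
      · rfl)
    (fun p => by
      rw [Matrix.of_apply, if_pos rfl, add_eq_left]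
      split_ifs with h
      · rw [extendZero_of_le _ h.ge]
      · rfl)

theorem colVec_apply (j : Fin n) (b : {i : Fin n // i < j} → F) (p q : Fin n) :
    (colVec j b : Matrix (Fin n) (Fin n) F) p q =
      (if p = q then 1 else 0) + if q = j then extendZero j b p else 0 := rfl

theorem colVec_mem (j : Fin n) (b : {i : Fin n // i < j} → F) : colVec j b ∈ unitri n F :=
  mkUnitri_mem _ _ _

theorem colVec_mul_apply (j : Fin n) (b : {i : Fin n // i < j} → F)
    (A : Matrix (Fin n) (Fin n) F) (p q : Fin n) :
    ((colVec j b : Matrix (Fin n) (Fin n) F) * A) p q = A p q + extendZero j b p * A j q := by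
  rw [Matrix.mul_apply]
  simp [colVec_apply, add_mul, Finset.sum_add_distrib]

theorem mul_colVec_apply (j : Fin n) (b : {i : Fin n // i < j} → F)
    (A : Matrix (Fin n) (Fin n) F) (p q : Fin n) :
    (A * (colVec j b : Matrix (Fin n) (Fin n) F)) p q =
      A p q + if q = j then A.mulVec (extendZero j b) p else 0 := by
  rw [Matrix.mul_apply]
  simp only [colVec_apply, mul_add, Finset.sum_add_distrib, mul_ite, mul_one, mul_zero,
    Finset.sum_ite_eq', Finset.mem_univ, if_true]
  congr 1
  split_ifs
  · rfl
  · simp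

theorem isBlockId_colVec (j : Fin n) (b : {i : Fin n // i < j} → F) : IsBlockId j (colVec j b) := by
  intro p q h
  rw [colVec_apply, add_eq_left]
  split_ifs with hq
  · rcases h with h | h
    · exact extendZero_of_le _ h
    · exact absurd hq h.ne'
  · rfl

theorem colVec_add (j : Fin n) (a b : {i : Fin n // i < j} → F) :
    colVec j (a + b) = colVec j a * colVec j b := by
  ext p q
  rw [Units.val_mul, colVec_mul_apply, colVec_apply, colVec_apply, colVec_apply, extendZero_add,
    extendZero_of_le b le_rfl]
  by_cases hq : q = j
  · simp [hq, add_comm, add_left_comm]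
  · simp [hq, Ne.symm hq]

theorem colVec_zero (j : Fin n) : colVec j (0 : {i : Fin n // i < j} → F) = 1 := by
  have h := colVec_add j (0 : {i : Fin n // i < j} → F) 0
  rw [add_zero] at h
  exact (mul_eq_left.1 h.symm)

theorem superdiag_colVec (ε : Fin n → F) (j : Fin n) (b : {i : Fin n // i < j} → F) :
    superdiag ε (colVec j b) = ∑ i : Fin n, if (j : ℕ) = i + 1 then ε i * extendZero j b i else 0 := by
  refine Finset.sum_congr rfl fun i _ => ?_
  rw [Finset.sum_eq_single j]
  · split_ifs with h
    · rw [colVec_apply, if_pos rfl, if_neg, zero_add]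
      rintro rfl
      omega
    · rfl
  · intro q _ hq
    split_ifs with h
    · rw [colVec_apply, if_neg hq, if_neg, add_zero, mul_zero]
      rintro rfl
      omega
    · rfl
  · simp

/-- This factorisation drives the induction on columns: column j is a vector group normalising the
matrices supported in the later columns. -/
theorem exists_eq_colVec_mul (j : Fin n) {u : GL (Fin n) F} (hu : u ∈ unitri n F)
    (hu' : TrivialCols j u) :
    ∃ b : {i : Fin n // i < j} → F, ∃ v ∈ unitri n F, TrivialCols (j + 1) v ∧
      u = colVec j b * v := by
  refine ⟨fun i => (u : Matrix (Fin n) (Fin n) F) i j, _,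
    mul_mem (inv_mem (colVec_mem j _)) hu, ?_, (mul_inv_cancel_left _ u).symm⟩
  set b : {i : Fin n // i < j} → F := fun i => (u : Matrix (Fin n) (Fin n) F) i j with hb
  have hinv : (colVec j b)⁻¹ = colVec j (-b) := by
    rw [inv_eq_iff_mul_eq_one, ← colVec_add, add_neg_cancel, colVec_zero]
  intro p q hq
  rw [hinv, Units.val_mul, colVec_mul_apply]
  rcases Nat.lt_succ_iff_lt_or_eq.1 hq with hq | hq
  · rw [hu' p q hq, hu' j q hq, if_neg (show j ≠ q by rintro rfl; omega), mul_zero, add_zero]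
  · have hqj : q = j := Fin.ext hq
    subst hqj
    rw [hu.2, mul_one]
    unfold extendZero
    rcases lt_trichotomy p q with h | rfl | h
    · rw [dif_pos h, if_neg h.ne]
      simp [hb]
    · rw [dif_neg (lt_irrefl _), if_pos rfl, hu.2, add_zero]
    · rw [dif_neg (lt_asymm h), if_neg h.ne', unitri_apply_of_lt hu h, add_zero]

end Columns

/-! ### Existence of eigenvectors in any nonzero module, column by column. -/

section LinearCharacters

variable {n : ℕ} {F : Type*} [Field F]

theorem exists_isBlockId_row {j i : Fin n} (hi : i < j) {c : {i : Fin n // i < j} → F}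
    (hc : c ≠ 0) :
    ∃ g : GL (Fin n) F, IsBlockId j g ∧
      ∀ q, (g : Matrix (Fin n) (Fin n) F) i q = extendZero j c q := by
  obtain ⟨⟨k, hk⟩, hck⟩ := Function.ne_iff.1 hc
  -- Replacing row k of the identity by c gives determinant c_k ≠ 0; a transposition then carries
  -- row k to row i.
  have hdet : ((1 : Matrix (Fin n) (Fin n) F).updateRow k (extendZero j c)).det ≠ 0 := by
    have h := Matrix.det_updateRow_sum (1 : Matrix (Fin n) (Fin n) F) k (extendZero j c)
    have h1 : ∑ q, extendZero j c q • (1 : Matrix (Fin n) (Fin n) F) q = extendZero j c := by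
      ext q
      simp [Finset.sum_apply, Matrix.one_apply]
    rw [h1, Matrix.det_one, smul_eq_mul, mul_one, extendZero, dif_pos hk] at h
    rw [h]
    exact hck
  have hent : ∀ p q, ((permGL F (Equiv.swap k i) * Matrix.GeneralLinearGroup.mkOfDetNeZero _ hdet :
      GL (Fin n) F) : Matrix (Fin n) (Fin n) F) p q =
        if Equiv.swap k i p = k then extendZero j c q else
          if Equiv.swap k i p = q then 1 else 0 := by
    intro p q
    rw [Units.val_mul, permGL_mul_apply, Equiv.swap_inv]
    change (Matrix.updateRow _ _ _) _ _ = _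
    rw [Matrix.updateRow_apply, Matrix.one_apply]
  refine ⟨permGL F (Equiv.swap k i) * Matrix.GeneralLinearGroup.mkOfDetNeZero _ hdet,
    fun p q h => ?_, fun q => ?_⟩
  · rw [hent]
    rcases h with h | h
    · have h1 := (hk.trans_le h).ne'
      rw [Equiv.swap_apply_of_ne_of_ne h1 (hi.trans_le h).ne', if_neg h1]
    · have h1 : Equiv.swap k i q = q :=
        Equiv.swap_apply_of_ne_of_ne (hk.trans h).ne' (hi.trans h).ne'
      rw [extendZero_of_le _ h.le]
      by_cases hp : p = q
      · rw [hp, h1, if_neg (hk.trans h).ne', if_pos rfl]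
      · have h2 : Equiv.swap k i p ≠ q := fun h2 =>
          hp ((Equiv.swap k i).injective (h2.trans h1.symm))
        rw [if_neg h2, if_neg hp, ite_self]
  · rw [hent, Equiv.swap_apply_right, if_pos rfl]

/-- A linear form in column `j` can be moved, by an element that normalises the matrices supported
in the columns from `j` on, to a multiple in `{0, 1}` of the entry just above the diagonal. -/
theorem exists_normalising_element (j : Fin n) (c : {i : Fin n // i < j} → F) {ε : Fin n → F}
    (hε : ∀ i, ε i = 0 ∨ ε i = 1) :
    ∃ (η : Fin n → F) (g : GL (Fin n) F), (∀ i, η i = 0 ∨ η i = 1) ∧ IsBlockId j g ∧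
      (∀ b b' : {i : Fin n // i < j} → F,
        (g : Matrix (Fin n) (Fin n) F).mulVec (extendZero j b') = extendZero j b →
          ∑ i, c i * b' i = superdiag η (colVec j b)) ∧
      ∀ u : GL (Fin n) F, TrivialCols (j + 1) u → superdiag η u = superdiag ε u := by
  -- The value at index j - 1 may be changed freely: it multiplies an entry of column j, which is
  -- trivial in u.
  have hsup : ∀ (t : F) (u : GL (Fin n) F), TrivialCols (j + 1) u →
      superdiag (fun i => if (j : ℕ) = i + 1 then t else ε i) u = superdiag ε u := by
    intro t u hu
    refine Finset.sum_congr rfl fun p _ => Finset.sum_congr rfl fun q _ => ?_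
    by_cases h1 : (q : ℕ) = p + 1
    · rw [if_pos h1, if_pos h1]
      by_cases h2 : (j : ℕ) = p + 1
      · have hqj : q = j := Fin.ext (by omega)
        rw [hqj, hu p j (Nat.lt_succ_self _), if_neg, mul_zero, mul_zero]
        rintro rfl
        omega
      · simp only [if_neg h2]
    · rw [if_neg h1, if_neg h1]
  have hmem : ∀ t : F, (t = 0 ∨ t = 1) → ∀ i : Fin n,
      (if (j : ℕ) = i + 1 then t else ε i) = 0 ∨ (if (j : ℕ) = i + 1 then t else ε i) = 1 := by
    intro t ht i
    split_ifs
    · exact ht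
    · exact hε i
  by_cases hc : c = 0
  · refine ⟨_, 1, hmem 0 (Or.inl rfl), isBlockId_one j, fun b b' _ => ?_, hsup 0⟩
    rw [superdiag_colVec, hc, Finset.sum_eq_zero (fun i _ => by simp), eq_comm]
    refine Finset.sum_eq_zero fun i _ => ?_
    split_ifs with h
    · simp
    · rfl
  · obtain ⟨⟨k, hk⟩, -⟩ := Function.ne_iff.1 hc
    have hj := j.2
    rw [Fin.lt_def] at hk
    -- A nonzero c forces j > 0. Row j - 1 of g is chosen to be c, so entry j - 1 of g b' is ∑ c_i
    -- b'_i.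
    let i : Fin n := ⟨j - 1, by omega⟩
    have hij : (j : ℕ) = i + 1 := by simp only [i]; omega
    obtain ⟨g, hg, hrow⟩ := exists_isBlockId_row (i := i) (by rw [Fin.lt_def]; omega) hc
    refine ⟨_, g, hmem 1 (Or.inr rfl), hg, fun b b' hb => ?_, hsup 1⟩
    rw [superdiag_colVec, Finset.sum_eq_single i]
    · rw [if_pos hij, if_pos hij, one_mul, ← hb]
      simp only [Matrix.mulVec, dotProduct, hrow]
      rw [sum_extendZero_mul]
      refine Finset.sum_congr rfl fun p _ => ?_
      rw [extendZero, dif_pos p.2]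
    · intro q _ hq
      rw [if_neg]
      intro h
      exact hq (Fin.ext (by omega))
    · simp

variable {k : Type*} [CommRing k] [IsDomain k]
  {Q : Type*} [AddCommGroup Q] [Module k Q] [Module k[GL (Fin n) F] Q]
  [IsScalarTower k k[GL (Fin n) F] Q]

/-- A Fourier coefficient along the abelian column j makes x an eigenvector y for that column,
without disturbing the later ones. Translating by an element of the mirabolic type turns the linear
form on column j into 0 or the entry above the diagonal. -/
theorem exists_isEigen_step [Fintype F] {ψ : AddChar F k} (hψ : ψ ≠ 1)
    (hF : IsUnit (Fintype.card F : k)) (j : Fin n) {ε : Fin n → F} (hε : ∀ i, ε i = 0 ∨ ε i = 1)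
    {x : Q} (hx0 : x ≠ 0)
    (hx : ∀ u ∈ unitri n F, TrivialCols (j + 1) u →
      MonoidAlgebra.of k _ u • x = ψ (superdiag ε u) • x) :
    ∃ (η : Fin n → F) (y : Q), (∀ i, η i = 0 ∨ η i = 1) ∧ y ≠ 0 ∧
      ∀ u ∈ unitri n F, TrivialCols j u → MonoidAlgebra.of k _ u • y = ψ (superdiag η u) • y := by
  classical
  obtain ⟨c, hc⟩ := exists_char_sum_ne_zero hψ hF
    (fun a : {i : Fin n // i < j} → F => MonoidAlgebra.of k _ (colVec j a) • x)
    (by rwa [colVec_zero, map_one, one_smul])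
  set y := ∑ a : {i : Fin n // i < j} → F, ψ (-∑ i, c i * a i) •
    MonoidAlgebra.of k _ (colVec j a) • x with hy
  have hy1 : ∀ b, MonoidAlgebra.of k _ (colVec j b) • y = ψ (∑ i, c i * b i) • y := by
    intro b
    rw [hy, Finset.smul_sum, Finset.smul_sum]
    refine Fintype.sum_equiv (Equiv.addLeft b) _ _ fun a => ?_
    rw [smul_algebra_smul_comm, ← mul_smul, ← map_mul, ← colVec_add, smul_smul,
      ← AddChar.map_add_eq_mul, Equiv.coe_addLeft]
    congr 2
    simp [mul_add, Finset.sum_add_distrib]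
  have hy2 : ∀ u ∈ unitri n F, TrivialCols (j + 1) u →
      MonoidAlgebra.of k _ u • y = ψ (superdiag ε u) • y := by
    intro u hu hu'
    rw [hy, Finset.smul_sum, Finset.smul_sum]
    refine Finset.sum_congr rfl fun a _ => ?_
    have hg := isBlockId_colVec j a
    have h : u * colVec j a = colVec j a * ((colVec j a)⁻¹ * u * colVec j a) := by group
    rw [smul_algebra_smul_comm, ← mul_smul, ← map_mul, h, map_mul, mul_smul,
      hx _ (hg.conj_mem_unitri hu hu') (hu'.conj hg), hg.superdiag_conj ε hu',
      smul_algebra_smul_comm, smul_comm]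
  obtain ⟨η, g, hη, hg, hη1, hη2⟩ := exists_normalising_element j c hε
  refine ⟨η, MonoidAlgebra.of k _ g • y, hη, ?_, fun w hw hw' => ?_⟩
  · intro h0
    refine hc ?_
    rw [← one_smul k[GL (Fin n) F] y, ← map_one (MonoidAlgebra.of k (GL (Fin n) F)),
      ← inv_mul_cancel g, map_mul, mul_smul, h0, smul_zero]
  · obtain ⟨b, u, hu, hu', rfl⟩ := exists_eq_colVec_mul j hw hw'
    set b' : {i : Fin n // i < j} → F := fun i =>
      ((g⁻¹ : GL (Fin n) F) : Matrix (Fin n) (Fin n) F).mulVec (extendZero j b) i with hb'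
    have hext : extendZero j b' =
        ((g⁻¹ : GL (Fin n) F) : Matrix (Fin n) (Fin n) F).mulVec (extendZero j b) := by
      funext p
      by_cases hp : p < j
      · rw [extendZero, dif_pos hp]
      · rw [extendZero_of_le _ (not_lt.1 hp)]
        have h1 : ∀ q, ((g⁻¹ : GL (Fin n) F) : Matrix (Fin n) (Fin n) F) p q =
            if p = q then 1 else 0 := fun q => hg.inv p q (Or.inl (not_lt.1 hp))
        simp only [Matrix.mulVec, dotProduct, h1, ite_mul, one_mul, zero_mul, Finset.sum_ite_eq,
          Finset.mem_univ, if_true]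
        rw [extendZero_of_le _ (not_lt.1 hp)]
    have hgb : (g : Matrix (Fin n) (Fin n) F).mulVec (extendZero j b') = extendZero j b := by
      rw [hext, Matrix.mulVec_mulVec, ← Units.val_mul, mul_inv_cancel, Units.val_one,
        Matrix.one_mulVec]
    have hcomm : colVec j b * g = g * colVec j b' := by
      ext p q
      rw [Units.val_mul, Units.val_mul, colVec_mul_apply, mul_colVec_apply, hgb,
        hg j q (Or.inl le_rfl)]
      by_cases hq : q = j
      · simp [hq]
      · simp [hq, Ne.symm hq]
    have h : colVec j b * u * g = g * colVec j b' * (g⁻¹ * u * g) := by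
      rw [← hcomm]
      group
    rw [← mul_smul, ← map_mul, h, map_mul, mul_smul,
      hy2 _ (hg.conj_mem_unitri hu hu') (hu'.conj hg), hg.superdiag_conj ε hu',
      smul_algebra_smul_comm, map_mul, mul_smul, hy1, hη1 b b' hgb, smul_algebra_smul_comm,
      smul_smul, ← AddChar.map_add_eq_mul, superdiag_mul η (colVec_mem j b) hu, hη2 u hu',
      add_comm]

/-- Every nonzero `G`-module in which `p` is invertible has an eigenvector of `U` for one of the
characters `∑ ε_i u_{i,i+1}` with `ε_i ∈ {0, 1}`. -/
theorem exists_isEigen [Finite F] {ψ : AddChar F k} (hψ : ψ ≠ 1)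
    (hF : IsUnit (Nat.card F : k)) {x : Q} (hx : x ≠ 0) :
    ∃ (ε : Fin n → F) (y : Q), (∀ i, ε i = 0 ∨ ε i = 1) ∧ y ≠ 0 ∧ IsEigen ψ ε y := by
  have := Fintype.ofFinite F
  rw [Nat.card_eq_fintype_card] at hF
  -- Here d counts the columns, from the right, already treated.
  suffices H : ∀ d ≤ n, ∃ (ε : Fin n → F) (y : Q), (∀ i, ε i = 0 ∨ ε i = 1) ∧ y ≠ 0 ∧
      ∀ u ∈ unitri n F, TrivialCols (n - d) u →
        MonoidAlgebra.of k _ u • y = ψ (superdiag ε u) • y by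
    obtain ⟨ε, y, hε, hy0, hy⟩ := H n le_rfl
    exact ⟨ε, y, hε, hy0, fun u hu => hy u hu fun p q hq => by omega⟩
  intro d
  induction d with
  | zero =>
    intro _
    refine ⟨fun _ => 0, x, fun _ => Or.inl rfl, hx, fun u _ hu' => ?_⟩
    have : u = 1 := Units.ext (Matrix.ext fun p q => by
      rw [hu' p q (by have := q.2; omega), Units.val_one, Matrix.one_apply])
    rw [this, map_one, one_smul, superdiag_one, AddChar.map_zero_eq_one, one_smul]
  | succ d ih =>
    intro hd
    obtain ⟨ε, y, hε, hy0, hy⟩ := ih (by omega)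
    -- Columns are numbered from 0, so the next one to treat is n - (d + 1).
    have hj : n - d = ((⟨n - (d + 1), by omega⟩ : Fin n) : ℕ) + 1 := by simp only; omega
    rw [hj] at hy
    exact exists_isEigen_step hψ hF _ hε hy0 hy

end LinearCharacters

/-! ### A unit value of the form. -/

section Form

variable {n : ℕ} {F : Type*} [Field F]

/-- If all entries of `u ∈ U` above the diagonal are nonzero, then `u` does not normalise any
other coset `σ B` than `B`. -/
theorem perm_eq_one_of_conj_mem {u : GL (Fin n) F}
    (hu : ∀ i j, i ≤ j → (u : Matrix (Fin n) (Fin n) F) i j ≠ 0) {σ : Equiv.Perm (Fin n)}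
    (hσ : (permGL F σ)⁻¹ * u * permGL F σ ∈ borel n F) : σ = 1 := by
  -- An inversion of σ would place a nonzero entry of u below the diagonal; an increasing
  -- permutation is the identity.
  have hmono : StrictMono σ := by
    intro b a hba
    by_contra h
    have h1 := hσ a b hba
    rw [permGL_inv_mul_mul_apply] at h1
    exact hu _ _ (not_lt.1 h) h1
  exact (perm_eq_of_le fun i => hmono.le_apply).symm

variable (n F) in
/-- The unitriangular matrix all of whose entries above the diagonal are `1`. -/
def fullUnitri : GL (Fin n) F :=
  mkUnitri (Matrix.of fun i j => if i ≤ j then 1 else 0)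
    (fun i j h => by rw [Matrix.of_apply, if_neg (not_le.2 h)])
    (fun i => by rw [Matrix.of_apply, if_pos le_rfl])

theorem fullUnitri_mem : fullUnitri n F ∈ unitri n F := mkUnitri_mem _ _ _

variable [Finite F] {R : Type*} [CommRing R]

theorem coeff_steinbergElement_eq_zero {g : GL (Fin n) F}
    (hg : ∀ σ : Equiv.Perm (Fin n), (permGL F σ)⁻¹ * g ∉ borel n F) :
    (steinbergElement n F R).coeff g = 0 := by
  classical
  simp only [steinbergElement_eq, MonoidAlgebra.coeff_sum, MonoidAlgebra.coeff_smul,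
    Finsupp.coe_finsetSum, Finset.sum_apply, Finsupp.smul_apply, coeff_cosetSum]
  exact Finset.sum_eq_zero fun σ _ => by rw [if_neg (hg σ), smul_zero]

variable [IsDomain R] [CharZero R]

theorem form_symm (x y : lattice n F R) : form n F R x y = form n F R y x := by
  have := Fintype.ofFinite (GL (Fin n) F)
  have hB : (Nat.card (borel n F) : R) ≠ 0 := Nat.cast_ne_zero.2 Nat.card_pos.ne'
  apply mul_left_cancel₀ hB
  rw [form_spec, form_spec, canonicalForm_eq_sum, canonicalForm_eq_sum]
  exact Finset.sum_congr rfl fun g _ => mul_comm _ _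

/-- The supports of the generator and its translate meet only in B, where both coefficients are 1.
The canonical form is thus |B|, and the scaling turns it into 1. -/
theorem form_gen_fullUnitri :
    form n F R (gen n F R) (MonoidAlgebra.of R _ (fullUnitri n F) • gen n F R) = 1 := by
  classical
  have := Fintype.ofFinite (GL (Fin n) F)
  have hB : (Nat.card (borel n F) : R) ≠ 0 := Nat.cast_ne_zero.2 Nat.card_pos.ne'
  apply mul_left_cancel₀ hB
  rw [form_spec, canonicalForm_eq_sum, mul_one]
  set u := fullUnitri n F with hu
  have hfull : ∀ i j, i ≤ j → (u : Matrix (Fin n) (Fin n) F) i j ≠ 0 := by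
    intro i j hij
    change (if i ≤ j then (1 : F) else 0) ≠ 0
    rw [if_pos hij]
    exact one_ne_zero
  have hinv : ∀ g : GL (Fin n) F,
      ((MonoidAlgebra.of R _ u • gen n F R : lattice n F R) : R[GL (Fin n) F]).coeff g =
        (steinbergElement n F R).coeff (u⁻¹ * g) := by
    intro g
    change (MonoidAlgebra.of R _ u * steinbergElement n F R).coeff g = _
    simp [MonoidAlgebra.coeff_single_mul_apply]
  have hR : ∀ g b : GL (Fin n) F, b ∈ borel n F →
      (steinbergElement n F R).coeff (g * b) = (steinbergElement n F R).coeff g :=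
    fun g b hb => coeff_mul_borel n F R _ (gen n F R).2 g b hb
  have key : ∀ g : GL (Fin n) F, (steinbergElement n F R).coeff g *
      (steinbergElement n F R).coeff (u⁻¹ * g) = if g ∈ borel n F then 1 else 0 := by
    intro g
    by_cases h : ∃ σ : Equiv.Perm (Fin n), (permGL F σ)⁻¹ * g ∈ borel n F
    · obtain ⟨σ, hσ⟩ := h
      have hg : g = permGL F σ * ((permGL F σ)⁻¹ * g) := by group
      have h1 : (steinbergElement n F R).coeff g =
          ((Equiv.Perm.sign σ : ℤ) : R) := by
        rw [hg, hR _ _ hσ, ← one_mul (permGL F σ), coeff_steinbergElement (one_mem _), if_pos]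
        rw [mul_one, inv_mul_cancel]
        exact one_mem _
      have h2 : (steinbergElement n F R).coeff (u⁻¹ * g) =
          if (permGL F σ)⁻¹ * u⁻¹ * permGL F σ ∈ borel n F then
            ((Equiv.Perm.sign σ : ℤ) : R) else 0 := by
        rw [hg, ← mul_assoc, hR _ _ hσ, coeff_steinbergElement (inv_mem fullUnitri_mem)]
      rw [h1, h2]
      by_cases hσ1 : σ = 1
      · subst hσ1
        rw [permGL_one, inv_one, one_mul] at hσ
        rw [if_pos hσ, permGL_one, inv_one, one_mul, mul_one,
          if_pos (inv_mem (unitri_le_borel fullUnitri_mem))]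
        simp
      · rw [if_neg, if_neg, mul_zero]
        · intro hgB
          refine hσ1 (eq_of_mem_borel (F := F) (one_mem (unitri n F)) (σ := 1) ?_)
          have := mul_mem hσ (inv_mem hgB)
          simpa [permGL_one] using this
        · intro hc
          refine hσ1 (perm_eq_one_of_conj_mem hfull ?_)
          have := inv_mem hc
          simpa [mul_assoc] using this
    · push Not at h
      rw [coeff_steinbergElement_eq_zero h, zero_mul, if_neg]
      intro hg
      refine h 1 ?_
      rwa [permGL_one, inv_one, one_mul]
  have hsum : ∑ g : GL (Fin n) F, (if g ∈ borel n F then (1 : R) else 0) =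
      (Nat.card (borel n F) : R) := by
    rw [Finset.sum_boole, Nat.card_eq_fintype_card, Fintype.card_subtype]
  rw [← hsum]
  exact Finset.sum_congr rfl fun g _ => by rw [hinv]; exact key g

end Form

/-! ### Regular eigenvectors generate L; orthogonality and L(1). -/

section Regular

variable {n : ℕ} {F : Type*} [Field F] [Finite F] {R : Type*} [CommRing R] {ℓ : ℕ}

/-- The lattice `L` is generated by any eigenvector of `U` for a character in general position. -/
theorem eq_top_of_isEigen (hmax : (Ideal.span {(ℓ : R)}).IsMaximal)
    (hU : IsUnit (Nat.card (unitri n F) : ResField R ℓ))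
    (hF : IsUnit (Nat.card F : ResField R ℓ)) {ψ : AddChar F (ResField R ℓ)} (hψ : ψ ≠ 1)
    {N : Submodule (ResField R ℓ)[GL (Fin n) F] (Reduction n F R ℓ)}
    {x : Reduction n F R ℓ} (hxN : x ∈ N) (hx0 : x ≠ 0)
    (hx : IsEigen (n := n) ψ (fun _ => 1) x) : N = ⊤ := by
  have := Fintype.ofFinite (unitri n F)
  let _ := Ideal.Quotient.field (Ideal.span {(ℓ : R)})
  by_contra hN
  obtain ⟨z, hz⟩ : ∃ z, z ∉ N := by
    by_contra! h
    exact hN (eq_top_iff.2 fun z _ => h z)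
  have hz' : N.mkQ z ≠ 0 := by
    rwa [Submodule.mkQ_apply, ne_eq, Submodule.Quotient.mk_eq_zero]
  -- The projection of a lift w of q lies on the eigenline for ε, which N already contains. So it
  -- vanishes in the quotient, yet its image is |U| q ≠ 0.
  obtain ⟨ε, q, hε, hq0, hq⟩ := exists_isEigen (n := n) hψ hF hz'
  obtain ⟨w, rfl⟩ := N.mkQ_surjective q
  obtain ⟨y, hyN, hy0, hy⟩ := exists_isEigen_of_regular hU hxN hx0 hx ε hε
  have hcoeff : IsUnit (redCoeff n F R ℓ (permGL F Fin.revPerm) y) :=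
    isUnit_iff_ne_zero.2 fun h => hy0 (IsEigen.eq_zero hU hy h)
  obtain ⟨c, hc⟩ := hy.exists_smul hU (isEigen_eigenSum ψ ε w) hcoeff
  have h1 : N.mkQ (eigenSum _ _ ψ ε w) = 0 := by
    rw [Submodule.mkQ_apply, Submodule.Quotient.mk_eq_zero, hc]
    exact N.smul_of_tower_mem c hyN
  have h2 : N.mkQ (eigenSum _ _ ψ ε w) = eigenSum _ _ ψ ε (N.mkQ w) := by
    rw [eigenSum_apply, eigenSum_apply, map_sum]
    rfl
  rw [h2, eigenSum_of_isEigen hq] at h1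
  exact hq0 (hU.smul_eq_zero.1 h1)

variable (n F R ℓ) in
/-- The form with `x ∈ I`, modulo `ℓ`, as a function on `L`. -/
def redForm (x : lattice n F R) : Reduction n F R ℓ →+ ResField R ℓ :=
  (Submodule.liftQ (Ideal.span {(ℓ : R)} • ⊤ : Submodule R (lattice n F R))
    ((Submodule.mkQ (Ideal.span {(ℓ : R)})).comp (form n F R x)) (by
      rw [Submodule.smul_le]
      intro r hr y _
      rw [LinearMap.mem_ker, map_smul, Algebra.smul_def]
      have : (algebraMap R (ResField R ℓ)) r = 0 := Ideal.Quotient.eq_zero_iff_mem.2 hr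
      rw [this, zero_mul])).toAddMonoidHom

theorem redForm_toReduction (x y : lattice n F R) :
    redForm n F R ℓ x (toReduction n F R ℓ y) = Ideal.Quotient.mk _ (form n F R x y) := rfl

theorem redForm_smul (x : lattice n F R) (c : ResField R ℓ) (y : Reduction n F R ℓ) :
    redForm n F R ℓ x (c • y) = c * redForm n F R ℓ x y := by
  obtain ⟨r, rfl⟩ := Ideal.Quotient.mk_surjective c
  obtain ⟨y, rfl⟩ := toReduction_surjective y
  rw [smul_toReduction, redForm_toReduction, redForm_toReduction, ← map_mul, map_smul]
  rfl

variable [IsDomain R] [CharZero R]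

theorem redForm_of_smul (g : GL (Fin n) F) (x : lattice n F R) (y : Reduction n F R ℓ) :
    redForm n F R ℓ x (MonoidAlgebra.of (ResField R ℓ) _ g • y) =
      redForm n F R ℓ (MonoidAlgebra.of R _ g⁻¹ • x) y := by
  obtain ⟨y, rfl⟩ := toReduction_surjective y
  rw [of_smul_toReduction, redForm_toReduction, redForm_toReduction, form_of_smul, inv_inv]

theorem redForm_symm (x y : lattice n F R) :
    redForm n F R ℓ x (toReduction n F R ℓ y) = redForm n F R ℓ y (toReduction n F R ℓ x) := by
  rw [redForm_toReduction, redForm_toReduction, form_symm]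

/-- The orthogonal complement of a submodule of `L`. -/
def redPerp (N : Submodule (ResField R ℓ)[GL (Fin n) F] (Reduction n F R ℓ)) :
    Submodule (ResField R ℓ)[GL (Fin n) F] (Reduction n F R ℓ) where
  carrier := {y | ∀ x, toReduction n F R ℓ x ∈ N → redForm n F R ℓ x y = 0}
  zero_mem' := fun x _ => map_zero _
  add_mem' := fun {a b} ha hb x hx => by rw [map_add, ha x hx, hb x hx, add_zero]
  smul_mem' := by
    intro r y hy x hx
    induction r using MonoidAlgebra.induction_linear with
    | zero => rw [zero_smul, map_zero]
    | add a b ha hb => rw [add_smul, map_add, ha, hb, add_zero]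
    | single g a =>
      have h : (MonoidAlgebra.single g a : (ResField R ℓ)[GL (Fin n) F]) • y =
          a • (MonoidAlgebra.of (ResField R ℓ) _ g • y) := by
        rw [← smul_assoc, MonoidAlgebra.of_apply, MonoidAlgebra.smul_single, smul_eq_mul, mul_one]
      rw [h, redForm_smul, redForm_of_smul, hy, mul_zero]
      rw [← of_smul_toReduction]
      exact N.smul_mem _ hx

theorem le_filtration_one (hmax : (Ideal.span {(ℓ : R)}).IsMaximal)
    (hU : IsUnit (Nat.card (unitri n F) : ResField R ℓ))
    (hF : IsUnit (Nat.card F : ResField R ℓ)) {ψ : AddChar F (ResField R ℓ)} (hψ : ψ ≠ 1)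
    {N : Submodule (ResField R ℓ)[GL (Fin n) F] (Reduction n F R ℓ)} (hN : N ≠ ⊤) :
    N ≤ filtration n F R ℓ 1 := by
  have := Fintype.ofFinite (unitri n F)
  let _ := Ideal.Quotient.field (Ideal.span {(ℓ : R)})
  have hzero : ∀ x ∈ N, eigenSum (n := n) _ _ ψ (fun _ => 1) x = 0 := by
    intro x hx
    by_contra h0
    exact hN (eq_top_of_isEigen hmax hU hF hψ (eigenSum_mem (n := n) ψ _ hx) h0
      (isEigen_eigenSum (n := n) ψ _ x))
  -- The substitution u ↦ u⁻¹ shows that the projections for ψ and ψ⁻¹ are adjoint. As the first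
  -- kills N, the image of the second is orthogonal to N.
  have hperp : redPerp N = ⊤ := by
    refine eq_top_of_isEigen hmax hU hF (inv_ne_one.2 hψ) (x := eigenSum (n := n) _ _ ψ⁻¹ (fun _ => 1)
      (toReduction n F R ℓ (gen n F R))) ?_ ?_ (isEigen_eigenSum (n := n) ψ⁻¹ _ _)
    · intro x hx
      have h1 : redForm n F R ℓ x (eigenSum (n := n) _ _ ψ⁻¹ (fun _ => 1)
          (toReduction n F R ℓ (gen n F R))) =
          redForm n F R ℓ (gen n F R) (eigenSum (n := n) _ _ ψ (fun _ => 1)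
            (toReduction n F R ℓ x)) := by
        rw [eigenSum_apply, eigenSum_apply, map_sum, map_sum]
        refine Fintype.sum_equiv (Equiv.inv _) _ _ fun u => ?_
        rw [redForm_smul, redForm_smul, redForm_of_smul, redForm_symm, of_smul_toReduction,
          AddChar.inv_apply, Equiv.inv_apply, Subgroup.coe_inv, superdiag_inv _ u.2]
      rw [h1, hzero _ hx, map_zero]
    · intro h0
      have h := redCoeff_eigenSum_gen (n := n) (R := R) (ℓ := ℓ) ψ⁻¹ (fun _ => (1 : F))
      rw [h0, map_zero] at h
      rcases Int.units_eq_one_or (Equiv.Perm.sign (Fin.revPerm : Equiv.Perm (Fin n))) with hs | hs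
        <;> simp [hs] at h
  intro x hx
  obtain ⟨x, rfl⟩ := toReduction_surjective x
  refine ⟨x, fun y => ?_, rfl⟩
  have h : toReduction n F R ℓ y ∈ redPerp N := hperp ▸ Submodule.mem_top
  have h1 := h x hx
  rw [redForm_toReduction, Ideal.Quotient.eq_zero_iff_mem] at h1
  rwa [pow_one]

/-- Modulo ℓ the form depends only on classes in L, and the class of the generator pairs to 1 with a
translate of itself. -/
theorem filtration_one_ne_top (hmax : (Ideal.span {(ℓ : R)}).IsMaximal) :
    filtration n F R ℓ 1 ≠ ⊤ := by
  intro h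
  have h1 : toReduction n F R ℓ (gen n F R) ∈ filtration n F R ℓ 1 := h ▸ Submodule.mem_top
  obtain ⟨x, hx, hxg⟩ := h1
  have h2 := hx (MonoidAlgebra.of R _ (fullUnitri n F) • gen n F R)
  rw [pow_one, ← Ideal.Quotient.eq_zero_iff_mem, form_symm, ← redForm_toReduction, hxg,
    redForm_toReduction, form_symm, form_gen_fullUnitri, map_one] at h2
  have := Ideal.Quotient.nontrivial_iff.2 hmax.ne_top
  exact one_ne_zero h2

theorem filtration_zero : filtration n F R ℓ 0 = ⊤ := by
  refine eq_top_iff.2 fun x _ => ?_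
  obtain ⟨x, rfl⟩ := toReduction_surjective x
  exact ⟨x, fun y => by simp, rfl⟩

end Regular

/-! ### A nontrivial additive character with values in K. -/

section Arithmetic

/-- The character of the prime field defined by ζ is composed with the trace, which is surjective.
-/
theorem exists_addChar_ne_one {F K : Type*} [Field F] [Finite F] [Field K] {p : ℕ}
    [Fact p.Prime] [CharP F p] {ζ : K} (hζ : IsPrimitiveRoot ζ p) :
    ∃ ψ : AddChar F K, ψ ≠ 1 := by
  let _ := ZMod.algebra F p
  have hprim := AddChar.zmodChar_primitive_of_primitive_root p hζ
  set χ := AddChar.zmodChar p ((IsPrimitiveRoot.iff_def ζ p).1 hζ).1 with hχ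
  have h1 : χ ≠ 1 := by
    have := hprim one_ne_zero
    rwa [AddChar.mulShift_one] at this
  obtain ⟨t, ht⟩ := AddChar.ne_one_iff.1 h1
  obtain ⟨a, rfl⟩ := Algebra.trace_surjective (ZMod p) F t
  exact ⟨χ.compAddMonoidHom (Algebra.trace (ZMod p) F).toAddMonoidHom,
    AddChar.ne_one_iff.2 ⟨a, ht⟩⟩

/-- Being a root of the cyclotomic polynomial passes through f, and it implies primitivity where p ≠
0. -/
theorem isPrimitiveRoot_map {R K : Type*} [CommRing R] [IsDomain R] [CommRing K]
    [IsDomain K] (f : R →+* K) {ζ : R} {p : ℕ} (hζ : IsPrimitiveRoot ζ p) (hp : (p : K) ≠ 0) :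
    IsPrimitiveRoot (f ζ) p := by
  have : NeZero (p : K) := ⟨hp⟩
  have hpos : 0 < p := Nat.pos_of_ne_zero fun h => hp (by simp [h])
  rw [← Polynomial.isRoot_cyclotomic_iff, ← Polynomial.map_cyclotomic p f]
  exact (hζ.isRoot_cyclotomic hpos).map

end Arithmetic

end Steinberg

end

/-! ### The main theorem. -/

theorem mainTheorem5
    (n : ℕ) (hn : 2 ≤ n)
    (p ℓ : ℕ) (hp : p.Prime) (hℓ : ℓ.Prime) (hℓp : ℓ ≠ p)
    (F : Type*) [Field F] [Finite F] [CharP F p]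
    (R : Type*) [CommRing R] [IsDomain R] [IsPrincipalIdealRing R] [IsLocalRing R] [CharZero R]
    (hmax : IsLocalRing.maximalIdeal R = Ideal.span {(ℓ : R)})
    (hζ : ∃ ζ : R, IsPrimitiveRoot ζ p) :
    -- the filtration starts at `L`: `L(0) = L`
    Steinberg.filtration n F R ℓ 0 = ⊤ ∧
    -- `M(0) = L(0)/L(1)` is irreducible
    IsSimpleModule (Steinberg.ResField R ℓ)[GL (Fin n) F] (Steinberg.Factor n F R ℓ 0) ∧
    -- so `L/L(1)` is irreducible
    IsSimpleModule (Steinberg.ResField R ℓ)[GL (Fin n) F]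
      (Steinberg.Reduction n F R ℓ ⧸ Steinberg.filtration n F R ℓ 1) ∧
    -- all proper submodules of `L` are contained in `L(1)`
    (∀ N : Submodule (Steinberg.ResField R ℓ)[GL (Fin n) F] (Steinberg.Reduction n F R ℓ),
      N ≠ ⊤ → N ≤ Steinberg.filtration n F R ℓ 1) ∧
    -- `L(1)` is the unique maximal submodule of `L`
    (∀ N : Submodule (Steinberg.ResField R ℓ)[GL (Fin n) F] (Steinberg.Reduction n F R ℓ),
      IsCoatom N ↔ N = Steinberg.filtration n F R ℓ 1) ∧
    -- `rad(L) = L(1)`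
    Module.jacobson (Steinberg.ResField R ℓ)[GL (Fin n) F] (Steinberg.Reduction n F R ℓ) =
      Steinberg.filtration n F R ℓ 1 := by
  have : Fact p.Prime := ⟨hp⟩
  have hmaxI : (Ideal.span {(ℓ : R)}).IsMaximal := hmax ▸ IsLocalRing.maximalIdeal.isMaximal R
  let _ := Ideal.Quotient.field (Ideal.span {(ℓ : R)})
  have hℓ0 : (ℓ : Steinberg.ResField R ℓ) = 0 := by
    rw [← map_natCast (Ideal.Quotient.mk (Ideal.span {(ℓ : R)}))]
    exact Ideal.Quotient.eq_zero_iff_mem.2 (Ideal.mem_span_singleton_self _)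
  -- A Bézout relation between ℓ and p, read in K where ℓ = 0, inverts p.
  have hp0 : IsUnit (p : Steinberg.ResField R ℓ) := by
    have h := (Nat.isCoprime_iff_coprime.2 ((Nat.coprime_primes hℓ hp).2 hℓp)).map
      (Int.castRingHom (Steinberg.ResField R ℓ))
    simpa [hℓ0, isCoprime_zero_left] using h
  have hU : IsUnit (Nat.card (Steinberg.unitri n F) : Steinberg.ResField R ℓ) := by
    obtain ⟨m, hm⟩ := Steinberg.card_unitri (n := n) (F := F) p
    rw [hm, Nat.cast_pow]
    exact hp0.pow m
  have hF : IsUnit (Nat.card F : Steinberg.ResField R ℓ) := by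
    have := Fintype.ofFinite F
    obtain ⟨m, -, hm⟩ := FiniteField.card F p
    rw [Nat.card_eq_fintype_card, hm, Nat.cast_pow]
    exact hp0.pow _
  obtain ⟨ζ, hζ⟩ := hζ
  obtain ⟨ψ, hψ⟩ := Steinberg.exists_addChar_ne_one (F := F)
    (Steinberg.isPrimitiveRoot_map (Ideal.Quotient.mk (Ideal.span {(ℓ : R)})) hζ hp0.ne_zero)
  have hle : ∀ N : Submodule (Steinberg.ResField R ℓ)[GL (Fin n) F] (Steinberg.Reduction n F R ℓ),
      N ≠ ⊤ → N ≤ Steinberg.filtration n F R ℓ 1 :=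
    fun N hN => Steinberg.le_filtration_one hmaxI hU hF hψ hN
  have hne := Steinberg.filtration_one_ne_top (n := n) (F := F) hmaxI
  have hcoatom : IsCoatom (Steinberg.filtration n F R ℓ 1) := by
    refine ⟨hne, fun N hN => ?_⟩
    by_contra h
    exact not_le_of_gt hN (hle N h)
  have hiff : ∀ N : Submodule (Steinberg.ResField R ℓ)[GL (Fin n) F]
      (Steinberg.Reduction n F R ℓ), IsCoatom N ↔ N = Steinberg.filtration n F R ℓ 1 :=
    fun N => ⟨fun hN => (hN.le_iff_eq hne).1 (hle N hN.1) |>.symm, fun h => h ▸ hcoatom⟩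
  have hsimple := isSimpleModule_iff_isCoatom.2 hcoatom
  have h0 := Steinberg.filtration_zero (n := n) (F := F) (R := R) (ℓ := ℓ)
  refine ⟨h0, ?_, hsimple, hle, hiff, ?_⟩
  · exact IsSimpleModule.congr (Submodule.Quotient.equiv _ (Steinberg.filtration n F R ℓ 1)
      (LinearEquiv.ofTop _ h0) (by
        ext x
        simp [Submodule.submoduleOf, h0]))
  · rw [Module.jacobson]
    simp [hiff]
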